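/- **Conventions.** An instance of $4$-SUM consists of four sequences $A_1,A_2,A_3,A_4$, each containing $n$ integers of absolute value at most $n^{O(1)}$, that is, at most $C n^{e}$ for some fixed constants $C,e$. It is a yes-instance if there are indices $i_1,i_2,i_3,i_4$ with $A_1[i_1]+A_2[i_2]+A_3[i_3]+A_4[i_4]=0$. Instances are given as binary strings (in a self-delimiting binary encoding), and $n$, the length of the sequences, is the size parameter. A decision problem belongs to $\mathsf{AM}[s(n),t(n)]$ if there is a deterministic verifier (a random access machine with logarithmic cost, which reads the instance, the public coins and the proof bit by bit from read-only tapes) such that for each instance $x$ of size parameter $n$ and a uniformly random string $\rho$ of public coins, which is seen by both parties: * for all $\rho$ and all proofs $\pi\in\{0,1\}^*$ of length at most $s(n)$, where $\pi$ may depend on $\rho$, the verifier halts on $(x,\rho,\pi)$ within time $t(n)$; * if $x$ is a yes-instance, then with probability at least $2/3$ over $\rho$ there is a proof $\pi$ of length at most $s(n)$ such that the verifier accepts $(x,\rho,\pi)$; * if $x$ is a no-instance, then with probability $1$ over $\rho$ the verifier rejects $(x,\rho,\pi)$ for every proof $\pi$ of length at most $s(n)$. **Theorem.** $4\text{-SUM}\in\mathsf{AM}[\log_2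 n,\widetilde O(n)]$. That is, for all constants $C,e\in\mathbb N$ there is a function $t(n)=O(n\log^{k} n)$, for some constant $k$, such that $4$-SUM for integers of absolute value at most $C n^{e}$ belongs to $\mathsf{AM}[\log_2 n,t(n)]$. -/

import Mathlib

namespace ArthurMerlin

/-! ### Random access machines with logarithmic cost -/

/-- The three read-only tapes of a verifier: the instance, the public coins, the proof.
Each of them is read one bit at a time from left to right. -/
inductive Tape
  | input
  | coins
  | proof
  deriving DecidableEq

/-- Arithmetic operations on integers (division and remainder are Euclidean; `z / 0 = 0` and
`z % 0 = z`). -/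
inductive Op
  | add
  | sub
  | mul
  | div
  | mod

def Op.eval : Op → ℤ → ℤ → ℤ
  | .add, x, y => x + y
  | .sub, x, y => x - y
  | .mul, x, y => x * y
  | .div, x, y => x / y
  | .mod, x, y => x % y

/-- Instructions; `M` is the memory, and program lines are numbered from `0`. -/
inductive Instr
  /-- `M[d] := z` -/
  | const (d : ℕ) (z : ℤ)
  /-- `M[d] := M[a] ∘ M[b]` -/
  | arith (o : Op) (d a b : ℕ)
  /-- `M[d] := M[M[a]]` -/
  | load (d a : ℕ)
  /-- `M[M[a]] := M[b]` -/
  | store (a b : ℕ)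
  /-- go to line `l` -/
  | jump (l : ℕ)
  /-- go to line `l` if `M[a] = 0` -/
  | jumpZero (a l : ℕ)
  /-- go to line `l` if `M[a] > 0` -/
  | jumpPos (a l : ℕ)
  /-- `M[d] :=` the next bit (`0` or `1`) of the tape `τ`, or `-1` if that tape is exhausted -/
  | read (τ : Tape) (d : ℕ)
  /-- stop; accept if `b` is true, reject if `b` is false -/
  | halt (b : Bool)

/-- A program is a fixed finite list of instructions. -/
abbrev Program := List Instr

/-- A configuration: the current line, the memory, and the unread part of each tape. -/
structure Config where
  pc : ℕ
  mem : ℕ → ℤ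
  tape : Tape → List Bool

/-- The bit length of an integer, sign included. -/
def bitLength (z : ℤ) : ℕ := Nat.size z.natAbs + 1

/-- The memory address denoted by an integer (negative integers denote address `0`). -/
def address (z : ℤ) : ℕ := z.toNat

/-- The value delivered by reading from a tape with the given unread part. -/
def readValue : List Bool → ℤ
  | [] => -1
  | false :: _ => 0
  | true :: _ => 1

/-- Write `z` into memory cell `d` and proceed to the next line. -/
def Config.write (c : Config) (d : ℕ) (z : ℤ) : Config :=
  { c with pc := c.pc + 1, mem := Function.update c.mem d z }

/-- The effect of one instruction (that of `halt` is described by `Halts` below). -/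
def Instr.exec (c : Config) : Instr → Config
  | .const d z => c.write d z
  | .arith o d a b => c.write d (o.eval (c.mem a) (c.mem b))
  | .load d a => c.write d (c.mem (address (c.mem a)))
  | .store a b => c.write (address (c.mem a)) (c.mem b)
  | .jump l => { c with pc := l }
  | .jumpZero a l => { c with pc := if c.mem a = 0 then l else c.pc + 1 }
  | .jumpPos a l => { c with pc := if 0 < c.mem a then l else c.pc + 1 }
  | .read τ d =>
      { (c.write d (readValue (c.tape τ))) with
        tape := Function.update c.tape τ (c.tape τ).tail }
  | .halt _ => c

/-- The logarithmic cost of an instruction: the total bit length of all the integers and all the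
addresses that it handles. It is always at least `1`. -/
def Instr.cost (c : Config) : Instr → ℕ
  | .const d z => bitLength d + bitLength z
  | .arith o d a b =>
      bitLength d + bitLength a + bitLength b +
        bitLength (c.mem a) + bitLength (c.mem b) + bitLength (o.eval (c.mem a) (c.mem b))
  | .load d a =>
      bitLength d + bitLength a + bitLength (c.mem a) + bitLength (c.mem (address (c.mem a)))
  | .store a b => bitLength a + bitLength b + bitLength (c.mem a) + bitLength (c.mem b)
  | .jump _ => 1
  | .jumpZero a _ => bitLength a + bitLength (c.mem a)
  | .jumpPos a _ => bitLength a + bitLength (c.mem a)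
  | .read _ d => bitLength d + 1
  | .halt _ => 1

/-- `Halts P c b T`: started in configuration `c`, the program `P` executes a `halt b` instruction
after finitely many steps, and the total cost of the computation is `T`. -/
inductive Halts (P : Program) : Config → Bool → ℕ → Prop
  | halt {c : Config} {b : Bool} (h : P[c.pc]? = some (.halt b)) : Halts P c b 1
  | step {c : Config} {i : Instr} {b : Bool} {T : ℕ} (h : P[c.pc]? = some i)
      (hi : ∀ b', i ≠ .halt b') (hT : Halts P (i.exec c) b T) : Halts P c b (i.cost c + T)

/-- The initial configuration: line `0`, memory filled with zeros, and the given three tapes. -/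
def start (x ρ π : List Bool) : Config where
  pc := 0
  mem := fun _ => 0
  tape
    | .input => x
    | .coins => ρ
    | .proof => π

def Accepts (P : Program) (x ρ π : List Bool) : Prop := ∃ T, Halts P (start x ρ π) true T

def Rejects (P : Program) (x ρ π : List Bool) : Prop := ∃ T, Halts P (start x ρ π) false T

def HaltsWithin (P : Program) (x ρ π : List Bool) (t : ℕ) : Prop :=
  ∃ b T, Halts P (start x ρ π) b T ∧ T ≤ t

/-! ### Arthur–Merlin protocols -/

/-- A decision problem: instances with a size parameter and a binary encoding, and the set of
yes-instances. -/
structure DecisionProblem where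
  Inst : Type
  size : Inst → ℕ
  encode : Inst → List Bool
  encode_injective : Function.Injective encode
  Yes : Inst → Prop

/-- The probability of the event `E` over a uniformly random string of `R` bits. -/
noncomputable def coinProb {R : ℕ} (E : Set (Fin R → Bool)) : ℝ := (E.ncard : ℝ) / 2 ^ R

/-- The class `AM[s(n), t(n)]`, where `n` is the size parameter of the instance. Arthur is a
deterministic machine that gets the instance, the public coins and a proof of at most `s(n)` bits,
which Merlin chooses after he has seen the coins. Arthur always stops within time `t(n)`; he
accepts some proof with probability at least `2/3` on each yes-instance, and he rejects every proof
with probability `1` on each no-instance. The coins form a string of `t(n)` bits. As reading a bit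
has cost at least `1`, Arthur never gets to the end of this string. -/
def AM (s : ℕ → ℝ) (t : ℕ → ℕ) : Set DecisionProblem :=
  {L | ∃ P : Program, ∀ x : L.Inst,
    (∀ (ρ : Fin (t (L.size x)) → Bool) (π : List Bool), (π.length : ℝ) ≤ s (L.size x) →
      HaltsWithin P (L.encode x) (List.ofFn ρ) π (t (L.size x))) ∧
    (L.Yes x →
      2 / 3 ≤ coinProb {ρ : Fin (t (L.size x)) → Bool | ∃ π : List Bool,
        (π.length : ℝ) ≤ s (L.size x) ∧ Accepts P (L.encode x) (List.ofFn ρ) π}) ∧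
    (¬ L.Yes x →
      coinProb {ρ : Fin (t (L.size x)) → Bool | ∀ π : List Bool,
        (π.length : ℝ) ≤ s (L.size x) → Rejects P (L.encode x) (List.ofFn ρ) π} = 1)}

/-- `t(n) = Õ(f(n))`: up to a power of `log n`, the function `t` is `O(f)`. -/
def IsSoftO (t : ℕ → ℕ) (f : ℕ → ℝ) : Prop :=
  ∃ k : ℕ, (fun n => (t n : ℝ)) =O[Filter.atTop] fun n : ℕ => f n * Real.log n ^ k

/-! ### The problem `k`-SUM -/

/-- Self-delimiting binary code of a natural number: each binary digit, the least significant one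
first, is preceded by a bit `1`, and a bit `0` marks the end. -/
def encodeNat (m : ℕ) : List Bool := m.bits.flatMap (fun b => [true, b]) ++ [false]

/-- Code of an integer: a sign bit (`1` for negative integers) and the code of the absolute
value. -/
def encodeInt (z : ℤ) : List Bool := decide (z < 0) :: encodeNat z.natAbs

/-- An instance of `k`-SUM: `k` sequences of `n` integers of absolute value at most `C * n ^ e`. -/
structure KSumInstance (k C e : ℕ) where
  n : ℕ
  A : Fin k → Fin n → ℤ
  bound : ∀ j i, |A j i| ≤ (C : ℤ) * (n : ℤ) ^ e

/-- The number `n`, followed by the entries of the `k` sequences, one sequence after the other. -/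
def KSumInstance.encode {k C e : ℕ} (I : KSumInstance k C e) : List Bool :=
  encodeNat I.n ++
    (List.finRange k).flatMap fun j => (List.finRange I.n).flatMap fun i => encodeInt (I.A j i)

theorem bits_code_inj (l l' u u' : List Bool)
    (h : (l.flatMap (fun b => [true, b]) ++ [false]) ++ u =
      (l'.flatMap (fun b => [true, b]) ++ [false]) ++ u') : l = l' ∧ u = u' := by
  induction l generalizing l' with
  | nil => cases l' <;> simp_all
  | cons a l ih =>
    cases l' with
    | nil => simp at h
    | cons b l' =>
      simp only [List.flatMap_cons, List.cons_append, List.nil_append, List.cons.injEq,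
        true_and] at h
      obtain ⟨rfl, h⟩ := h
      obtain ⟨rfl, rfl⟩ := ih l' (by simpa using h)
      exact ⟨rfl, rfl⟩

theorem encodeNat_append_inj {m m' : ℕ} {u u' : List Bool}
    (h : encodeNat m ++ u = encodeNat m' ++ u') : m = m' ∧ u = u' := by
  obtain ⟨h1, h2⟩ := bits_code_inj _ _ _ _ h
  refine ⟨?_, h2⟩
  exact Nat.digits_inj_iff.1 (by rw [Nat.digits_two_eq_bits, Nat.digits_two_eq_bits, h1])

theorem encodeInt_append_inj {z z' : ℤ} {u u' : List Bool}
    (h : encodeInt z ++ u = encodeInt z' ++ u') : z = z' ∧ u = u' := by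
  simp only [encodeInt, List.cons_append, List.cons.injEq, decide_eq_decide] at h
  obtain ⟨h1, h2⟩ := h
  obtain ⟨h3, h4⟩ := encodeNat_append_inj h2
  exact ⟨by omega, h4⟩

theorem flatMap_append_inj {α β : Type} {f : α → β → List Bool}
    (hf : ∀ a b b' u u', f a b ++ u = f a b' ++ u' → b = b' ∧ u = u') (g g' : α → β)
    (l : List α) (u u' : List Bool)
    (h : (l.flatMap fun a => f a (g a)) ++ u = (l.flatMap fun a => f a (g' a)) ++ u') :
    (∀ a ∈ l, g a = g' a) ∧ u = u' := by
  induction l with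
  | nil => simpa using h
  | cons a l ih =>
    simp only [List.flatMap_cons, List.append_assoc] at h
    obtain ⟨h1, h2⟩ := hf _ _ _ _ _ h
    obtain ⟨h3, h4⟩ := ih h2
    exact ⟨by simpa using ⟨h1, h3⟩, h4⟩

theorem KSumInstance.encode_injective {k C e : ℕ} :
    Function.Injective (KSumInstance.encode (k := k) (C := C) (e := e)) := by
  rintro ⟨n, A, hA⟩ ⟨n', A', hA'⟩ h
  obtain ⟨h1, h2⟩ := encodeNat_append_inj h
  dsimp only at h1
  subst h1
  have key := flatMap_append_inj (α := Fin k) (β := Fin n → ℤ)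
    (f := fun _ b => (List.finRange n).flatMap fun i => encodeInt (b i))
    (fun _ b b' u u' hb => by
      obtain ⟨h3, h4⟩ := flatMap_append_inj (α := Fin n) (β := ℤ) (f := fun _ z => encodeInt z)
        (fun _ _ _ _ _ hz => encodeInt_append_inj hz) b b' _ u u' hb
      exact ⟨funext fun i => h3 i (List.mem_finRange i), h4⟩)
    A A' (List.finRange k) [] [] (by simpa using h2)
  have hAA : A = A' := funext fun j => key.1 j (List.mem_finRange j)
  subst hAA
  rfl

/-- The problem `k`-SUM for integers of absolute value at most `C * n ^ e`: is there a choice of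
one entry from each sequence such that the chosen entries sum to zero? The size parameter is the
common length `n` of the sequences. -/
def kSum (k C e : ℕ) : DecisionProblem where
  Inst := KSumInstance k C e
  size I := I.n
  encode := KSumInstance.encode
  encode_injective := KSumInstance.encode_injective
  Yes I := ∃ i : Fin k → Fin I.n, ∑ j, I.A j (i j) = 0

end ArthurMerlin

/-! Let `L` be the first power of two above `4 * C * n ^ e` and `H` the largest one up to `n`. The
coins give a uniform multiplier `a` modulo `L * H`, and a number `x` is hashed to the leading part
`h x < H` of `a * x` modulo `L * H`. This hash is almost linear: since `a * x = L * H * q + L * h x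
+ r` with `0 ≤ r < L`, the hashes of four numbers with sum zero add up to `-d` modulo `H` for some
`d < 4` (`exists_dvd_hash_add`).

Merlin picks a solution and sends `r = h x₁ + h x₂` modulo `H`, which takes `Nat.log 2 n` bits.
Arthur puts the second and the fourth sequence into hash buckets. He lists the pairs from the first
two sequences whose hashes add up to `r - d`, and the pairs from the last two whose hashes add up to
`-r - d`, for `d < 4`. The sums of the first list are marked in a table indexed by the sum itself,
and the negated sums of the second list are looked up there. Whatever the coins and the proof are,
only true sums of entries enter the lists, so soundness is perfect. An honest solution can be missed
only because Arthur abandons each list after `6000 * n` steps.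

That this is rare is a first moment estimate. Fix a solution and put `s = x₁ + x₂`. A pair is listed
only if `a * (x + y - s)` is within `5 * L` of a multiple of `L * H`. Pairs with `x + y = s` are
harmless: as buckets hold distinct values, each `x` has at most one such `y`. For any other pair, at
most `120 * L` of the `L * H` multipliers are bad (`card_near_le`). Since `n ≤ 2 * H`, the two lists
together expect at most `480 * n` such collisions, and by Markov's inequality more than `1440 * n`
occur with probability at most `1 / 3` (`card_many_collisions_le`). Otherwise each list takes at
most `8 * n + 4 * 1440 * n ≤ 6000 * n` steps (`load_le`).

To run this on the machine, a small structured language with variables and integer-indexed arrays is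
compiled to machine code, at a cost of at most a constant times the number of steps times the bit
length of the numbers stored (`Cmd.verifier_halts`). Tables need no initialization, because memory
starts at zero, and a far address costs only its bit length. There are `O(n log n)` steps on numbers
of `O(log n)` bits. -/

namespace ArthurMerlin

/-! ### A structured language for random access machines -/

/-- `Steps P c c' T`: the program `P` goes from `c` to `c'` without halting, at total cost `T`. -/
inductive Steps (P : Program) : Config → Config → ℕ → Prop
  | refl (c : Config) : Steps P c c 0
  | step {c c' : Config} {i : Instr} {T : ℕ} (h : P[c.pc]? = some i)
      (hi : ∀ b', i ≠ .halt b') (hT : Steps P (i.exec c) c' T) : Steps P c c' (i.cost c + T)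

theorem Steps.trans {P : Program} {c c' c'' : Config} {T T' : ℕ} (h : Steps P c c' T)
    (h' : Steps P c' c'' T') : Steps P c c'' (T + T') := by
  induction h with
  | refl => simpa using h'
  | step h hi _ ih => rw [add_assoc]; exact .step h hi (ih h')

theorem Steps.halts {P : Program} {c c' : Config} {T T' : ℕ} {b : Bool} (h : Steps P c c' T)
    (h' : Halts P c' b T') : Halts P c b (T + T') := by
  induction h with
  | refl => simpa using h'
  | step h hi _ ih => rw [add_assoc]; exact .step h hi (ih h')

/-- `Reach P c c' B`: the program `P` goes from `c` to `c'` without halting, at cost at most `B`. -/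
def Reach (P : Program) (c c' : Config) (B : ℕ) : Prop := ∃ T ≤ B, Steps P c c' T

theorem Reach.trans {P : Program} {c c' c'' : Config} {B B' B'' : ℕ} (h : Reach P c c' B)
    (h' : Reach P c' c'' B') (hB : B + B' ≤ B'') : Reach P c c'' B'' := by
  obtain ⟨T, hT, s⟩ := h
  obtain ⟨T', hT', s'⟩ := h'
  exact ⟨_, (add_le_add hT hT').trans hB, s.trans s'⟩

theorem Reach.single {P : Program} {c c' : Config} {i : Instr} (h : P[c.pc]? = some i)
    (hi : ∀ b', i ≠ .halt b') (hc : i.exec c = c') : Reach P c c' (i.cost c) :=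
  ⟨_, le_rfl, hc ▸ .step h hi (.refl _)⟩

/-- The instruction list `code` occurs in `P` from line `l` on. -/
def CodeAt (P : Program) (l : ℕ) (code : List Instr) : Prop := code <+: P.drop l

theorem CodeAt.left {P : Program} {l : ℕ} {u v : List Instr} (h : CodeAt P l (u ++ v)) :
    CodeAt P l u := (List.prefix_append u v).trans h

theorem CodeAt.right {P : Program} {l : ℕ} {u v : List Instr} (h : CodeAt P l (u ++ v)) :
    CodeAt P (l + u.length) v := by
  obtain ⟨s, hs⟩ := h
  refine ⟨s, ?_⟩
  rw [← List.drop_drop, ← hs]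
  simp

theorem CodeAt.get {P : Program} {l : ℕ} {i : Instr} {v : List Instr} (h : CodeAt P l (i :: v)) :
    P[l]? = some i := by
  obtain ⟨s, hs⟩ := h
  have : (P.drop l)[0]? = some i := by rw [← hs]; simp
  simpa using this

/-! ### Bit lengths of integers -/

theorem bitLength_pos (z : ℤ) : 1 ≤ bitLength z := by simp [bitLength]

theorem bitLength_natCast_le {d k : ℕ} (h : d < 2 ^ k) : bitLength (d : ℤ) ≤ k + 1 := by
  simpa [bitLength] using Nat.size_le.2 h

theorem bitLength_le_of_abs_le {z : ℤ} {N : ℕ} (h : |z| ≤ N) :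
    bitLength z ≤ bitLength N := by
  simp only [bitLength, Int.natAbs_natCast, add_le_add_iff_right]
  exact Nat.size_le_size (by zify; exact h)

/-- A sum may need one bit more than the longer operand; this is absorbed because both bit lengths
on the right include a sign bit. Division by zero does no harm, as `x % 0 = x` and `x / 0 = 0`. -/
theorem Op.bitLength_eval_le (o : Op) (x y : ℤ) :
    bitLength (o.eval x y) ≤ bitLength x + bitLength y := by
  have key : ∀ z : ℤ, z.natAbs ≤ x.natAbs + y.natAbs → bitLength z ≤ bitLength x + bitLength y := by
    intro z hz
    have hx := Nat.lt_size_self x.natAbs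
    have hy := Nat.lt_size_self y.natAbs
    have h1 : 2 ^ x.natAbs.size ≤ 2 ^ (x.natAbs.size + y.natAbs.size) :=
      Nat.pow_le_pow_right (by norm_num) (by omega)
    have h2 : 2 ^ y.natAbs.size ≤ 2 ^ (x.natAbs.size + y.natAbs.size) :=
      Nat.pow_le_pow_right (by norm_num) (by omega)
    have h3 : z.natAbs.size ≤ x.natAbs.size + y.natAbs.size + 1 :=
      Nat.size_le.2 (by rw [pow_succ]; omega)
    simp only [bitLength]; omega
  cases o with
  | add => exact key _ (Int.natAbs_add_le x y)
  | sub => exact key _ (Int.natAbs_sub_le x y)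
  | mul =>
    have hx := Nat.lt_size_self x.natAbs
    have hy := Nat.lt_size_self y.natAbs
    have h3 : (x * y).natAbs.size ≤ x.natAbs.size + y.natAbs.size :=
      Nat.size_le.2 (by
        rw [pow_add, Int.natAbs_mul]
        exact Nat.mul_lt_mul'' hx hy)
    simp only [bitLength, Op.eval]; omega
  | div => exact key _ (le_add_right (Int.natAbs_ediv_le_natAbs x y))
  | mod =>
    refine key _ ?_
    simp only [Op.eval]
    rcases eq_or_ne y 0 with rfl | hy
    · simp
    · have := Int.emod_nonneg x hy
      have := Int.emod_lt_abs x hy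
      rw [abs_eq_max_neg] at this
      omega

/-- The state of a structured program: variables, arrays indexed by the integers, and tapes. -/
structure State where
  var : ℕ → ℤ
  arr : ℕ → ℤ → ℤ
  tape : Tape → List Bool

def State.setVar (σ : State) (v : ℕ) (z : ℤ) : State :=
  { σ with var := Function.update σ.var v z }

def State.setArr (σ : State) (t : ℕ) (i z : ℤ) : State :=
  { σ with arr := Function.update σ.arr t (Function.update (σ.arr t) i z) }

def State.read (σ : State) (τ : Tape) (v : ℕ) : State :=
  { σ.setVar v (readValue (σ.tape τ)) with
    tape := Function.update σ.tape τ (σ.tape τ).tail }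

/-- All numbers in the state have absolute value at most `N`. -/
def State.Bounded (N : ℕ) (σ : State) : Prop :=
  (∀ v, |σ.var v| ≤ N) ∧ ∀ t i, |σ.arr t i| ≤ N

/-- The memory address of the array cell `t[i]`. -/
def cell (t : ℕ) (i : ℤ) : ℤ := 16 * (i * (i + i + 1)) + (64 + t : ℕ)

theorem le_cell (t : ℕ) (i : ℤ) : 64 ≤ cell t i := by
  have : 0 ≤ i * (i + i + 1) := by
    rcases le_or_gt 0 i with h | h
    · positivity
    · exact mul_nonneg_of_nonpos_of_nonpos h.le (by omega)
  unfold cell; push_cast; linarith [Int.natCast_nonneg t]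

/-- The residue modulo `16` separates the arrays. The map `i ↦ i * (2 * i + 1)` is injective on the
integers because the difference of two values is `(i - i') * (2 * (i + i') + 1)`, whose second
factor is odd. Cells are at least `64`, so passing to natural numbers loses nothing. -/
theorem cell_inj {t t' : ℕ} {i i' : ℤ} (ht : t < 16) (ht' : t' < 16)
    (h : address (cell t i) = address (cell t' i')) : t = t' ∧ i = i' := by
  have h1 : cell t i = cell t' i' := by
    have := le_cell t i
    have := le_cell t' i'
    unfold address at h; omega
  unfold cell at h1
  generalize hu : i * (i + i + 1) = u at h1
  generalize hu' : i' * (i' + i' + 1) = u' at h1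
  have h2 : t = t' := by omega
  have h3 : u = u' := by omega
  refine ⟨h2, ?_⟩
  have h4 : (i - i') * (2 * (i + i') + 1) = 0 := by rw [← hu, ← hu'] at h3; linear_combination h3
  rcases mul_eq_zero.1 h4 with h | h <;> omega

/-- The memory `mem` represents the state `σ`. -/
structure Represents (σ : State) (mem : ℕ → ℤ) : Prop where
  var : ∀ v < 31, mem v = σ.var v
  zero : mem 31 = 0
  arr : ∀ t < 16, ∀ i, mem (address (cell t i)) = σ.arr t i

theorem Represents.of_eq {σ : State} {mem mem' : ℕ → ℤ} (h : Represents σ mem) {d : ℕ}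
    (hd : 32 ≤ d) (h' : ∀ i, i < d ∨ 64 ≤ i → mem' i = mem i) : Represents σ mem' where
  var v hv := by rw [h' v (by omega), h.var v hv]
  zero := by rw [h' 31 (by omega), h.zero]
  arr t ht i := by
    rw [h' _ (Or.inr (by have := le_cell t i; unfold address; omega)), h.arr t ht i]

/-- The code `f d` computes the value `val` into the memory cell `d`; it may overwrite the cells
from `d` to `63`, and it needs `k` of them. -/
def Computes (f : ℕ → List Instr) (k : ℕ) (val : State → ℤ) : Prop :=
  ∃ w : ℕ, ∀ (N : ℕ) (σ : State), σ.Bounded N → bitLength (val σ) ≤ w * bitLength N ∧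
    ∀ (P : Program) (l d : ℕ) (mem : ℕ → ℤ) (tape : Tape → List Bool), 32 ≤ d → d + k ≤ 64 →
      CodeAt P l (f d) → Represents σ mem →
      ∃ mem', Reach P ⟨l, mem, tape⟩ ⟨l + (f d).length, mem', tape⟩ (w * bitLength N) ∧
        mem' d = val σ ∧ ∀ i, i < d ∨ 64 ≤ i → mem' i = mem i

def constCode (z : ℤ) (d : ℕ) : List Instr := [.const d z]

/-- There is no copy instruction, so the content of the cell is added to that of cell `31`, which
always holds zero. -/
def varCode (v : ℕ) (d : ℕ) : List Instr := [.arith .add d v 31]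

def opCode (o : Op) (f g : ℕ → List Instr) (d : ℕ) : List Instr :=
  f d ++ g (d + 1) ++ [.arith o d d (d + 1)]

def cellCode (t : ℕ) (f : ℕ → List Instr) : ℕ → List Instr :=
  opCode .add (opCode .mul (constCode 16)
    (opCode .mul f (opCode .add (opCode .add f f) (constCode 1)))) (constCode (64 + t : ℕ))

def loadCode (f : ℕ → List Instr) (d : ℕ) : List Instr := f d ++ [.load d d]

theorem computes_const (z : ℤ) : Computes (constCode z) 1 (fun _ => z) := by
  refine ⟨7 + bitLength z, fun N σ _ => ?_⟩
  have hN := bitLength_pos N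
  refine ⟨by nlinarith, fun P l d mem tape hd hk hc _ => ?_⟩
  refine ⟨Function.update mem d z, (Reach.single hc.get (by simp) rfl).trans ⟨0, le_rfl, .refl _⟩
      ?_,
    by simp, fun i hi => by rw [Function.update_of_ne (by omega)]⟩
  have : bitLength (d : ℤ) ≤ 7 := bitLength_natCast_le (k := 6) (by omega)
  simp only [Instr.cost]
  nlinarith

theorem computes_var {v : ℕ} (hv : v < 31) : Computes (varCode v) 1 (fun σ => σ.var v) := by
  refine ⟨40, fun N σ hσ => ?_⟩
  have hN := bitLength_pos N
  have hb := bitLength_le_of_abs_le (hσ.1 v)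
  refine ⟨by linarith, fun P l d mem tape hd hk hc hr => ?_⟩
  refine ⟨Function.update mem d (σ.var v), (Reach.single hc.get (by simp) ?_).trans
    ⟨0, le_rfl, .refl _⟩ ?_, by simp, fun i hi => by rw [Function.update_of_ne (by omega)]⟩
  · simp [Instr.exec, Config.write, Op.eval, hr.zero, hr.var v hv, varCode]
  · have h1 : bitLength (d : ℤ) ≤ 7 := bitLength_natCast_le (k := 6) (by omega)
    have h2 : bitLength (v : ℤ) ≤ 7 := bitLength_natCast_le (k := 6) (by omega)
    have h3 : bitLength ((31 : ℕ) : ℤ) ≤ 7 := bitLength_natCast_le (k := 6) (by omega)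
    have h4 : bitLength 0 = 1 := by simp [bitLength]
    simp only [Instr.cost, Op.eval, hr.zero, hr.var v hv, add_zero, h4]
    linarith

theorem computes_op (o : Op) {f g : ℕ → List Instr} {k k' : ℕ} {val val' : State → ℤ}
    (hf : Computes f k val) (hg : Computes g k' val') :
    Computes (opCode o f g) (max k (k' + 1) + 1) (fun σ => o.eval (val σ) (val' σ)) := by
  obtain ⟨w, hf⟩ := hf
  obtain ⟨w', hg⟩ := hg
  refine ⟨21 + 3 * w + 3 * w', fun N σ hσ => ?_⟩
  have hN := bitLength_pos N
  obtain ⟨b1, hf⟩ := hf N σ hσ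
  obtain ⟨b2, hg⟩ := hg N σ hσ
  have b3 := o.bitLength_eval_le (val σ) (val' σ)
  refine ⟨by nlinarith, fun P l d mem tape hd hk hc hr => ?_⟩
  obtain ⟨m1, s1, v1, e1⟩ := hf P l d mem tape hd (by omega) hc.left.left hr
  obtain ⟨m2, s2, v2, e2⟩ := hg P _ (d + 1) m1 tape (by omega) (by omega)
    hc.left.right (hr.of_eq hd e1)
  have h1 : m2 d = val σ := by rw [e2 d (by omega), v1]
  have hc3 := hc.right
  rw [List.length_append, ← add_assoc] at hc3
  refine ⟨Function.update m2 d (o.eval (val σ) (val' σ)),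
    (s1.trans s2 le_rfl).trans (Reach.single hc3.get (by simp) ?_) ?_, by simp, ?_⟩
  · simp [Instr.exec, Config.write, h1, v2, opCode, add_assoc]
  · have h1' : bitLength (d : ℤ) ≤ 7 := bitLength_natCast_le (k := 6) (by omega)
    have h2' : bitLength ((d + 1 : ℕ) : ℤ) ≤ 7 := bitLength_natCast_le (k := 6) (by omega)
    simp only [Instr.cost, h1, v2]
    nlinarith
  · intro i hi
    rw [Function.update_of_ne (by omega), e2 i (by omega), e1 i hi]

theorem computes_cell {f : ℕ → List Instr} {k : ℕ} {val : State → ℤ} (t : ℕ)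
    (hf : Computes f k val) : Computes (cellCode t f) (k + 9) (fun σ => cell t (val σ)) := by
  obtain ⟨w, h⟩ := computes_op .add (computes_op .mul (computes_const 16)
    (computes_op .mul hf (computes_op .add (computes_op .add hf hf) (computes_const 1))))
      (computes_const (64 + t : ℕ))
  exact ⟨w, fun N σ hσ => ⟨(h N σ hσ).1, fun P l d mem tape hd hk hc hr =>
    (h N σ hσ).2 P l d mem tape hd (by omega) hc hr⟩⟩

theorem computes_load {f : ℕ → List Instr} {k : ℕ} {val : State → ℤ} {t : ℕ} (ht : t < 16)
    (hf : Computes f k (fun σ => cell t (val σ))) :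
    Computes (loadCode f) (k + 1) (fun σ => σ.arr t (val σ)) := by
  obtain ⟨w, hf⟩ := hf
  refine ⟨15 + 2 * w, fun N σ hσ => ?_⟩
  have hN := bitLength_pos N
  obtain ⟨b1, hf⟩ := hf N σ hσ
  have b3 := bitLength_le_of_abs_le (hσ.2 t (val σ))
  refine ⟨by nlinarith, fun P l d mem tape hd hk hc hr => ?_⟩
  obtain ⟨m1, s1, v1, e1⟩ := hf P l d mem tape hd (by omega) hc.left hr
  have hr1 := hr.of_eq hd e1
  refine ⟨Function.update m1 d (σ.arr t (val σ)),
    s1.trans (Reach.single hc.right.get (by simp) ?_) ?_, by simp, ?_⟩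
  · simp [Instr.exec, Config.write, v1, hr1.arr t ht, loadCode, add_assoc]
  · have h1' : bitLength (d : ℤ) ≤ 7 := bitLength_natCast_le (k := 6) (by omega)
    simp only [Instr.cost, v1, hr1.arr t ht]
    nlinarith
  · intro i hi
    rw [Function.update_of_ne (by omega), e1 i hi]

/-! ### Expressions, commands and their compilation -/

inductive Expr
  | const (z : ℤ)
  | var (v : ℕ)
  | op (o : Op) (e e' : Expr)
  | arr (t : ℕ) (e : Expr)

namespace Expr

def eval (σ : State) : Expr → ℤ
  | const z => z
  | var v => σ.var v
  | op o e e' => o.eval (e.eval σ) (e'.eval σ)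
  | arr t e => σ.arr t (e.eval σ)

def code : Expr → ℕ → List Instr
  | const z => constCode z
  | var v => varCode v
  | op o e e' => opCode o e.code e'.code
  | arr t e => loadCode (cellCode t e.code)

/-- The number of scratch cells needed. -/
def depth : Expr → ℕ
  | const _ => 1
  | var _ => 1
  | op _ e e' => max e.depth (e'.depth + 1) + 1
  | arr _ e => e.depth + 9 + 1

/-- All names of variables and arrays are in range. -/
def Valid : Expr → Prop
  | const _ => True
  | var v => v < 31
  | op _ e e' => e.Valid ∧ e'.Valid
  | arr t e => t < 16 ∧ e.Valid

/-- Intermediate values, such as the product in the hash function, may exceed the bound `N` on the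
stored numbers. Every operation at most adds up bit lengths, so a factor depending only on the
expression suffices. -/
theorem computes (e : Expr) (h : e.Valid) : Computes e.code e.depth (fun σ => e.eval σ) := by
  induction e with
  | const z => exact computes_const z
  | var v => exact computes_var h
  | op o e e' ih ih' => exact computes_op o (ih h.1) (ih' h.2)
  | arr t e ih => exact computes_load h.1 (computes_cell t (ih h.2))

end Expr

inductive Cmd
  | skip
  | assign (v : ℕ) (e : Expr)
  | store (t : ℕ) (i e : Expr)
  | read (τ : Tape) (v : ℕ)
  | seq (c c' : Cmd)
  | ite (e : Expr) (c c' : Cmd)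
  | loop (e : Expr) (c : Cmd)

/-- `Exec N c σ σ' t`: from the state `σ`, the command `c` leads to the state `σ'` in `t` steps, and
all the numbers that it writes have absolute value at most `N`. -/
inductive Exec (N : ℕ) : Cmd → State → State → ℕ → Prop
  | skip (σ : State) : Exec N .skip σ σ 0
  | assign {v : ℕ} {e : Expr} {σ : State} (h : |e.eval σ| ≤ N) :
      Exec N (.assign v e) σ (σ.setVar v (e.eval σ)) 1
  | store {t : ℕ} {i e : Expr} {σ : State} (h : |e.eval σ| ≤ N) :
      Exec N (.store t i e) σ (σ.setArr t (i.eval σ) (e.eval σ)) 1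
  | read (τ : Tape) (v : ℕ) (σ : State) : Exec N (.read τ v) σ (σ.read τ v) 1
  | seq {c c' : Cmd} {σ σ' σ'' : State} {t t' : ℕ} (h : Exec N c σ σ' t)
      (h' : Exec N c' σ' σ'' t') : Exec N (.seq c c') σ σ'' (t + t')
  | ite_pos {e : Expr} {c c' : Cmd} {σ σ' : State} {t : ℕ} (he : 0 < e.eval σ)
      (h : Exec N c σ σ' t) : Exec N (.ite e c c') σ σ' (t + 1)
  | ite_neg {e : Expr} {c c' : Cmd} {σ σ' : State} {t : ℕ} (he : ¬ 0 < e.eval σ)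
      (h : Exec N c' σ σ' t) : Exec N (.ite e c c') σ σ' (t + 1)
  | loop_pos {e : Expr} {c : Cmd} {σ σ' σ'' : State} {t t' : ℕ} (he : 0 < e.eval σ)
      (h : Exec N c σ σ' t) (h' : Exec N (.loop e c) σ' σ'' t') :
      Exec N (.loop e c) σ σ'' (t + 1 + t')
  | loop_neg {e : Expr} {c : Cmd} {σ : State} (he : ¬ 0 < e.eval σ) :
      Exec N (.loop e c) σ σ 1

namespace Cmd

def length : Cmd → ℕ
  | skip => 0
  | assign _ e => (e.code 32).length + 1
  | store t i e => (cellCode t i.code 32).length + (e.code 33).length + 1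
  | read _ _ => 1
  | seq c c' => c.length + c'.length
  | ite e c c' => (e.code 32).length + 1 + c'.length + 1 + c.length
  | .loop e c => (e.code 32).length + 2 + c.length + 1

/-- The code of a command that starts at line `l`. -/
def code : Cmd → ℕ → List Instr
  | skip, _ => []
  | assign v e, _ => e.code 32 ++ [.arith .add v 32 31]
  | store t i e, _ => cellCode t i.code 32 ++ e.code 33 ++ [.store 32 33]
  | read τ v, _ => [.read τ v]
  | seq c c', l => c.code l ++ c'.code (l + c.length)
  | ite e c c', l =>
      e.code 32 ++ [.jumpPos 32 (l + (e.code 32).length + 1 + c'.length + 1)] ++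
        c'.code (l + (e.code 32).length + 1) ++
        [.jump (l + ((e.code 32).length + 1 + c'.length + 1 + c.length))] ++
        c.code (l + (e.code 32).length + 1 + c'.length + 1)
  | .loop e c, l =>
      e.code 32 ++ [.jumpPos 32 (l + (e.code 32).length + 2),
        .jump (l + ((e.code 32).length + 2 + c.length + 1))] ++
        c.code (l + (e.code 32).length + 2) ++ [.jump l]

theorem length_code (c : Cmd) (l : ℕ) : (c.code l).length = c.length := by
  induction c generalizing l <;> simp_all [code, length] <;> ring

/-- All names are in range, and the expressions are not too deep. -/
def Valid : Cmd → Prop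
  | skip => True
  | assign v e => v < 31 ∧ e.Valid ∧ e.depth ≤ 30
  | store t i e => t < 16 ∧ i.Valid ∧ i.depth ≤ 20 ∧ e.Valid ∧ e.depth ≤ 30
  | read _ v => v < 31
  | seq c c' => c.Valid ∧ c'.Valid
  | ite e c c' => (e.Valid ∧ e.depth ≤ 30) ∧ c.Valid ∧ c'.Valid
  | .loop e c => (e.Valid ∧ e.depth ≤ 30) ∧ c.Valid

end Cmd

/-! ### Correctness of the compilation -/

theorem State.Bounded.setVar {N v : ℕ} {σ : State} {z : ℤ} (h : σ.Bounded N) (hz : |z| ≤ N) :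
    (σ.setVar v z).Bounded N := by
  refine ⟨fun u => ?_, h.2⟩
  by_cases hu : u = v
  · subst hu; simpa [State.setVar] using hz
  · simpa [State.setVar, hu] using h.1 u

theorem State.Bounded.setArr {N t : ℕ} {σ : State} {i z : ℤ} (h : σ.Bounded N) (hz : |z| ≤ N) :
    (σ.setArr t i z).Bounded N := by
  refine ⟨h.1, fun u j => ?_⟩
  by_cases hu : u = t
  · subst hu
    by_cases hj : j = i
    · subst hj; simpa [State.setArr] using hz
    · simpa [State.setArr, hj] using h.2 u j
  · simpa [State.setArr, hu] using h.2 u j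

theorem abs_readValue_le (l : List Bool) : |readValue l| ≤ 1 := by
  rcases l with _ | ⟨_ | _, _⟩ <;> simp [readValue]

theorem Exec.bounded {N : ℕ} (hN : 1 ≤ N) {c : Cmd} {σ σ' : State} {t : ℕ} (h : Exec N c σ σ' t)
    (hσ : σ.Bounded N) : σ'.Bounded N := by
  induction h with
  | skip => exact hσ
  | assign h => exact hσ.setVar h
  | store h => exact hσ.setArr h
  | read τ v σ =>
    exact hσ.setVar (v := v) ((abs_readValue_le (σ.tape τ)).trans (by exact_mod_cast hN))
  | seq _ _ ih ih' => exact ih' (ih hσ)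
  | ite_pos _ _ ih => exact ih hσ
  | ite_neg _ _ ih => exact ih hσ
  | loop_pos _ _ _ ih ih' => exact ih' (ih hσ)
  | loop_neg => exact hσ

theorem Represents.setVar {σ : State} {mem : ℕ → ℤ} (h : Represents σ mem) {v : ℕ} (hv : v < 31)
    (z : ℤ) : Represents (σ.setVar v z) (Function.update mem v z) where
  var u hu := by
    by_cases huv : u = v
    · subst huv; simp [State.setVar]
    · simp [State.setVar, huv, h.var u hu]
  zero := by rw [Function.update_of_ne (by omega), h.zero]
  arr t ht i := by
    have := le_cell t i
    rw [Function.update_of_ne (by unfold address; omega), h.arr t ht i]; rfl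

theorem Represents.setArr {σ : State} {mem : ℕ → ℤ} (h : Represents σ mem) {t : ℕ} (ht : t < 16)
    (i z : ℤ) : Represents (σ.setArr t i z) (Function.update mem (address (cell t i)) z) where
  var u hu := by
    have := le_cell t i
    rw [Function.update_of_ne (by unfold address; omega), h.var u hu]; rfl
  zero := by
    have := le_cell t i
    rw [Function.update_of_ne (by unfold address; omega), h.zero]
  arr u hu j := by
    by_cases huj : u = t ∧ j = i
    · obtain ⟨rfl, rfl⟩ := huj; simp [State.setArr]
    · rw [Function.update_of_ne (fun h' => huj (cell_inj hu ht h')), h.arr u hu j]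
      by_cases hut : u = t
      · subst hut
        have : j ≠ i := fun h' => huj ⟨rfl, h'⟩
        simp [State.setArr, this]
      · simp [State.setArr, hut]

/-- The compiled command simulates the execution, and its cost is at most `w` times the number of
steps times the bit length of the numbers. -/
def Simulates (c : Cmd) (w : ℕ) : Prop :=
  ∀ (N : ℕ) (σ σ' : State) (t : ℕ), Exec N c σ σ' t → 1 ≤ N → σ.Bounded N →
    ∀ (P : Program) (l : ℕ) (mem : ℕ → ℤ), CodeAt P l (c.code l) → Represents σ mem →
      ∃ mem', Reach P ⟨l, mem, σ.tape⟩ ⟨l + c.length, mem', σ'.tape⟩ (w * bitLength N * t) ∧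
        Represents σ' mem'

theorem simulates_assign {v : ℕ} {e : Expr} (h : (Cmd.assign v e).Valid) :
    ∃ w, Simulates (.assign v e) w := by
  obtain ⟨hv, he, hd⟩ := h
  obtain ⟨w, hw⟩ := e.computes he
  refine ⟨22 + 3 * w, ?_⟩
  intro N σ σ' t hx hN hσ P l mem hc hr
  cases hx with
  | assign hz =>
  have hN' := bitLength_pos N
  obtain ⟨b, h⟩ := hw N σ hσ
  obtain ⟨m, s, hv', hm⟩ := h P l 32 mem σ.tape le_rfl (by omega) hc.left hr
  have hr' := hr.of_eq le_rfl hm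
  refine ⟨Function.update m v (e.eval σ), s.trans (Reach.single hc.right.get (by simp) ?_) ?_,
    hr'.setVar hv _⟩
  · simp [Instr.exec, Config.write, hv', hr'.zero, Op.eval, Cmd.length, State.setVar, add_assoc]
  · have h1 : bitLength (v : ℤ) ≤ 6 := bitLength_natCast_le (k := 5) (by omega)
    have h2 : bitLength ((32 : ℕ) : ℤ) ≤ 7 := bitLength_natCast_le (k := 6) (by omega)
    have h3 : bitLength ((31 : ℕ) : ℤ) ≤ 7 := bitLength_natCast_le (k := 6) (by omega)
    have h4 : bitLength 0 = 1 := by simp [bitLength]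
    simp only [Instr.cost, hv', hr'.zero, Op.eval, add_zero, h4]
    nlinarith

theorem simulates_store {t : ℕ} {i e : Expr} (h : (Cmd.store t i e).Valid) :
    ∃ w, Simulates (.store t i e) w := by
  obtain ⟨ht, hi, hdi, he, hde⟩ := h
  obtain ⟨w, hw⟩ := computes_cell t (i.computes hi)
  obtain ⟨w', hw'⟩ := e.computes he
  refine ⟨14 + 2 * w + 2 * w', ?_⟩
  intro N σ σ' t hx hN hσ P l mem hc hr
  cases hx with
  | store hz =>
  have hN' := bitLength_pos N
  obtain ⟨b, h⟩ := hw N σ hσ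
  obtain ⟨b', h'⟩ := hw' N σ hσ
  obtain ⟨m, s, hv, hm⟩ := h P l 32 mem σ.tape le_rfl (by omega) hc.left.left hr
  have hr' := hr.of_eq le_rfl hm
  -- The target address stays in cell `32`, so the value is computed from cell `33` on. The depth
  -- limits keep both computations below cell `64`.
  obtain ⟨m', s', hv', hm'⟩ := h' P _ 33 m σ.tape (by omega) (by omega) hc.left.right hr'
  have hr2 := hr'.of_eq (by omega) hm'
  have hv2 : m' 32 = _ := (hm' 32 (by omega)).trans hv
  have hc3 := hc.right
  rw [List.length_append, ← add_assoc] at hc3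
  refine ⟨_, (s.trans s' le_rfl).trans (Reach.single hc3.get (by simp) ?_) ?_,
    hr2.setArr ht (i.eval σ) (e.eval σ)⟩
  · simp [Instr.exec, Config.write, hv', hv2, Cmd.length, State.setArr, add_assoc]
  · have h2 : bitLength ((32 : ℕ) : ℤ) ≤ 7 := bitLength_natCast_le (k := 6) (by omega)
    have h3 : bitLength ((33 : ℕ) : ℤ) ≤ 7 := bitLength_natCast_le (k := 6) (by omega)
    simp only [Instr.cost, hv', hv2]
    nlinarith

theorem simulates_read {τ : Tape} {v : ℕ} (h : (Cmd.read τ v).Valid) :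
    Simulates (.read τ v) 7 := by
  intro N σ σ' t hx hN hσ P l mem hc hr
  cases hx
  have hN' := bitLength_pos N
  refine ⟨Function.update mem v (readValue (σ.tape τ)),
    (Reach.single hc.get (by simp) ?_).trans ⟨0, le_rfl, .refl _⟩ ?_, ?_⟩
  · simp [Instr.exec, Config.write, Cmd.length, State.read]
  · have h1 : bitLength (v : ℤ) ≤ 6 := bitLength_natCast_le (k := 5) (by
      simp only [Cmd.Valid] at h; omega)
    simp only [Instr.cost]
    linarith
  · have := hr.setVar h (readValue (σ.tape τ))
    exact ⟨this.var, this.zero, this.arr⟩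

theorem simulates_seq {c c' : Cmd} {w w' : ℕ} (hc : Simulates c w) (hc' : Simulates c' w') :
    Simulates (.seq c c') (w + w') := by
  intro N σ σ' t hx hN hσ P l mem hP hr
  cases hx with
  | @seq _ _ _ σ₁ _ t t' h h' =>
  have hR := hP.right
  rw [Cmd.length_code] at hR
  obtain ⟨m, s, hm⟩ := hc N _ _ _ h hN hσ P l mem hP.left hr
  obtain ⟨m', s', hm'⟩ := hc' N _ _ _ h' hN (h.bounded hN hσ) P _ m hR hm
  rw [add_assoc] at s'
  refine ⟨m', s.trans s' ?_, hm'⟩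
  have : w * bitLength N * t ≤ (w + w') * bitLength N * t := by gcongr; omega
  have : w' * bitLength N * t' ≤ (w + w') * bitLength N * t' := by gcongr; omega
  linarith

/-- The code that evaluates a condition and jumps if it is positive. -/
theorem reach_condition {e : Expr} (he : e.Valid) (hd : e.depth ≤ 30) :
    ∃ w, ∀ (N : ℕ) (σ : State), σ.Bounded N → ∀ (P : Program) (l l' : ℕ) (mem : ℕ → ℤ),
      CodeAt P l (e.code 32 ++ [.jumpPos 32 l']) → Represents σ mem →
      ∃ mem', Reach P ⟨l, mem, σ.tape⟩
        ⟨if 0 < e.eval σ then l' else l + (e.code 32).length + 1, mem', σ.tape⟩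
          (w * bitLength N) ∧ Represents σ mem' := by
  obtain ⟨w, hw⟩ := e.computes he
  refine ⟨2 * w + 7, ?_⟩
  intro N σ hσ P l l' mem hc hr
  have hN' := bitLength_pos N
  obtain ⟨b, h⟩ := hw N σ hσ
  obtain ⟨m, s, hv', hm⟩ := h P l 32 mem σ.tape le_rfl (by omega) hc.left hr
  refine ⟨m, s.trans (Reach.single hc.right.get (by simp) ?_) ?_, hr.of_eq le_rfl hm⟩
  · simp [Instr.exec, hv']
  · have h2 : bitLength ((32 : ℕ) : ℤ) ≤ 7 := bitLength_natCast_le (k := 6) (by omega)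
    simp only [Instr.cost, hv']
    nlinarith

theorem reach_jump {P : Program} {l l' : ℕ} {u : List Instr} (h : CodeAt P l (.jump l' :: u))
    (mem : ℕ → ℤ) (tape : Tape → List Bool) : Reach P ⟨l, mem, tape⟩ ⟨l', mem, tape⟩ 1 :=
  Reach.single (i := .jump l') h.get (by simp) rfl

theorem simulates_ite {e : Expr} {c c' : Cmd} {w w' : ℕ} (he : e.Valid) (hd : e.depth ≤ 30)
    (hc : Simulates c w) (hc' : Simulates c' w') : ∃ w, Simulates (.ite e c c') w := by
  obtain ⟨u, hu⟩ := reach_condition he hd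
  refine ⟨u + 1 + w + w', ?_⟩
  intro N σ σ' t hx hN hσ P l mem hP hr
  have hN' := bitLength_pos N
  obtain ⟨m, s, hm⟩ := hu N σ hσ P l _ mem hP.left.left.left hr
  have hP1 := hP.left.left.right
  have hP2 := hP.left.right
  have hP3 := hP.right
  simp only [List.length_append, Cmd.length_code, List.length_cons, List.length_nil, zero_add,
    ← add_assoc] at hP1 hP2 hP3
  cases hx with
  | @ite_pos _ _ _ _ _ t hp h =>
    rw [if_pos hp] at s
    obtain ⟨m', s', hm'⟩ := hc N _ _ _ h hN hσ P _ m hP3 hm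
    refine ⟨m', ?_, hm'⟩
    simp only [Cmd.length, ← add_assoc]
    refine s.trans s' ?_
    have : (u + 1 + w + w') * bitLength N * (t + 1) = w * bitLength N * t + u * bitLength N +
      ((u + 1 + w') * bitLength N * t + w * bitLength N + (1 + w') * bitLength N) := by ring
    omega
  | @ite_neg _ _ _ _ _ t hp h =>
    rw [if_neg hp] at s
    obtain ⟨m', s', hm'⟩ := hc' N _ _ _ h hN hσ P _ m hP1 hm
    refine ⟨m', ?_, hm'⟩
    simp only [Cmd.length, ← add_assoc]
    refine (s.trans s' le_rfl).trans (reach_jump hP2 _ _) ?_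
    have : (u + 1 + w + w') * bitLength N * (t + 1) = w' * bitLength N * t + u * bitLength N +
      bitLength N + ((u + 1 + w) * bitLength N * t + (w + w') * bitLength N) := by ring
    omega

/-- Each evaluation of the condition counts as one step of `Exec`; that step pays for the condition
code and for the jumps. -/
theorem simulates_loop {e : Expr} {c : Cmd} {w : ℕ} (he : e.Valid) (hd : e.depth ≤ 30)
    (hc : Simulates c w) : ∃ w, Simulates (.loop e c) w := by
  obtain ⟨u, hu⟩ := reach_condition he hd
  refine ⟨u + 1 + w, ?_⟩
  intro N σ σ' t hx hN hσ P l mem hP hr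
  have hN' := bitLength_pos N
  have hP0 := hP.left.left
  rw [show ∀ a b : Instr, [a, b] = [a] ++ [b] from fun _ _ => rfl, ← List.append_assoc] at hP0
  have hP1 := hP.left.right
  have hP2 := hP.right
  have hP3 := hP0.right
  simp only [List.length_append, Cmd.length_code, List.length_cons, List.length_nil, zero_add,
    ← add_assoc] at hP1 hP2 hP3
  generalize hcc : Cmd.loop e c = cc at hx
  induction hx generalizing mem with
  | loop_pos hp h h' ih ih' =>
    rename_i e₁ c₁ σ σ₁ σ₂ t t'
    cases hcc
    obtain ⟨m, s, hm⟩ := hu N σ hσ P l _ mem hP0.left hr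
    rw [if_pos hp] at s
    obtain ⟨m', s', hm'⟩ := hc N _ _ _ h hN hσ P _ m hP1 hm
    obtain ⟨m2, s2, hm2⟩ := ih' (h.bounded hN hσ) m' hm' rfl
    refine ⟨m2, ((s.trans s' le_rfl).trans (reach_jump hP2 _ _) le_rfl).trans s2 ?_, hm2⟩
    have : (u + 1 + w) * bitLength N * (t + 1 + t') = w * bitLength N * t + u * bitLength N +
      bitLength N + (u + 1 + w) * bitLength N * t' +
        ((u + 1) * bitLength N * t + w * bitLength N) := by ring
    omega
  | loop_neg hp =>
    cases hcc
    obtain ⟨m, s, hm⟩ := hu N _ hσ P l _ mem hP0.left hr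
    rw [if_neg hp] at s
    refine ⟨m, ?_, hm⟩
    simp only [Cmd.length, ← add_assoc]
    refine s.trans (reach_jump hP3 _ _) ?_
    have : (u + 1 + w) * bitLength N * 1 = u * bitLength N + bitLength N + w * bitLength N := by
      ring
    omega
  | _ => cases hcc

theorem Cmd.simulates (c : Cmd) (h : c.Valid) : ∃ w, Simulates c w := by
  induction c with
  | skip =>
    refine ⟨0, ?_⟩
    intro N σ σ' t hx hN hσ P l mem hP hr
    cases hx
    exact ⟨mem, ⟨0, by simp, .refl _⟩, hr⟩
  | assign v e => exact simulates_assign h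
  | store t i e => exact simulates_store h
  | read τ v => exact ⟨7, simulates_read h⟩
  | seq c c' ih ih' =>
    obtain ⟨w, hw⟩ := ih h.1
    obtain ⟨w', hw'⟩ := ih' h.2
    exact ⟨_, simulates_seq hw hw'⟩
  | ite e c c' ih ih' =>
    obtain ⟨w, hw⟩ := ih h.2.1
    obtain ⟨w', hw'⟩ := ih' h.2.2
    exact simulates_ite h.1.1 h.1.2 hw hw'
  | loop e c ih =>
    obtain ⟨w, hw⟩ := ih h.2
    exact simulates_loop h.1.1 h.1.2 hw

/-- The machine that runs `c` and then accepts if the variable `v` is positive. -/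
def Cmd.verifier (c : Cmd) (v : ℕ) : Program :=
  c.code 0 ++ [.jumpPos v (c.length + 2), .halt false, .halt true]

def initialState (x ρ π : List Bool) : State where
  var _ := 0
  arr _ _ := 0
  tape := (start x ρ π).tape

/-- The extra step in `t + 1` pays for the final conditional jump and the `halt`. -/
theorem Cmd.verifier_halts (c : Cmd) (h : c.Valid) {v : ℕ} (hv : v < 31) :
    ∃ w : ℕ, ∀ (N : ℕ) (x ρ π : List Bool) (σ : State) (t : ℕ), 1 ≤ N →
      Exec N c (initialState x ρ π) σ t →
      ∃ T ≤ w * bitLength N * (t + 1),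
        Halts (c.verifier v) (start x ρ π) (decide (0 < σ.var v)) T := by
  obtain ⟨w, hw⟩ := c.simulates h
  refine ⟨w + 8, fun N x ρ π σ t hN hx => ?_⟩
  have hN' := bitLength_pos N
  have hb : (initialState x ρ π).Bounded N := by simp [State.Bounded, initialState]
  obtain ⟨m, s, hm⟩ := hw N _ _ _ hx hN hb (c.verifier v) 0 (fun _ => 0)
    (by simp [CodeAt, Cmd.verifier]) ⟨by simp [initialState], rfl, by simp [initialState]⟩
  have e0 : (c.verifier v)[c.length]? = some (.jumpPos v (c.length + 2)) := by
    simp [Cmd.verifier, Cmd.length_code]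
  have e1 : (c.verifier v)[c.length + 1]? = some (.halt false) := by
    simp [Cmd.verifier, Cmd.length_code]
  have e2 : (c.verifier v)[c.length + 2]? = some (.halt true) := by
    simp [Cmd.verifier, Cmd.length_code]
  rw [zero_add] at s
  obtain ⟨T, hT, s⟩ := s.trans (Reach.single e0 (by simp) rfl) le_rfl
  refine ⟨_, ?_, s.halts (.halt ?_)⟩
  · have h1 : bitLength (v : ℤ) ≤ 6 := bitLength_natCast_le (k := 5) (by omega)
    have h2 := bitLength_le_of_abs_le ((hx.bounded hN hb).1 v)
    simp only [Instr.cost, hm.var v hv] at hT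
    nlinarith
  · simp only [Instr.exec, hm.var v hv]
    by_cases hp : 0 < σ.var v
    · simp [hp, e2]
    · simp [hp, e1]


/-! ### Reasoning about structured programs -/

infixr:60 " ;; " => Cmd.seq

instance : Add Expr := ⟨Expr.op .add⟩
instance : Sub Expr := ⟨Expr.op .sub⟩
instance : Mul Expr := ⟨Expr.op .mul⟩
instance : Div Expr := ⟨Expr.op .div⟩
instance : Mod Expr := ⟨Expr.op .mod⟩

namespace Expr

variable (e e' : Expr) (σ : State)

@[simp] theorem eval_const (z : ℤ) : (const z).eval σ = z := rfl
@[simp] theorem eval_var (v : ℕ) : (var v).eval σ = σ.var v := rfl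
@[simp] theorem eval_arr (t : ℕ) : (arr t e).eval σ = σ.arr t (e.eval σ) := rfl
@[simp] theorem eval_add : (e + e').eval σ = e.eval σ + e'.eval σ := rfl
@[simp] theorem eval_sub : (e - e').eval σ = e.eval σ - e'.eval σ := rfl
@[simp] theorem eval_mul : (e * e').eval σ = e.eval σ * e'.eval σ := rfl
@[simp] theorem eval_div : (e / e').eval σ = e.eval σ / e'.eval σ := rfl
@[simp] theorem eval_mod : (e % e').eval σ = e.eval σ % e'.eval σ := rfl
@[simp] theorem valid_add : (e + e').Valid ↔ e.Valid ∧ e'.Valid := Iff.rfl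
@[simp] theorem depth_add : (e + e').depth = max e.depth (e'.depth + 1) + 1 := rfl
@[simp] theorem valid_sub : (e - e').Valid ↔ e.Valid ∧ e'.Valid := Iff.rfl
@[simp] theorem depth_sub : (e - e').depth = max e.depth (e'.depth + 1) + 1 := rfl
@[simp] theorem valid_mul : (e * e').Valid ↔ e.Valid ∧ e'.Valid := Iff.rfl
@[simp] theorem depth_mul : (e * e').depth = max e.depth (e'.depth + 1) + 1 := rfl
@[simp] theorem valid_div : (e / e').Valid ↔ e.Valid ∧ e'.Valid := Iff.rfl
@[simp] theorem depth_div : (e / e').depth = max e.depth (e'.depth + 1) + 1 := rfl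
@[simp] theorem valid_mod : (e % e').Valid ↔ e.Valid ∧ e'.Valid := Iff.rfl
@[simp] theorem depth_mod : (e % e').depth = max e.depth (e'.depth + 1) + 1 := rfl

end Expr

namespace State

variable (σ : State)

@[simp] theorem setVar_var (v u : ℕ) (z : ℤ) :
    (σ.setVar v z).var u = if u = v then z else σ.var u := by
  simp [setVar, Function.update_apply]
@[simp] theorem setVar_arr (v : ℕ) (z : ℤ) : (σ.setVar v z).arr = σ.arr := rfl
@[simp] theorem setVar_tape (v : ℕ) (z : ℤ) : (σ.setVar v z).tape = σ.tape := rfl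
@[simp] theorem setArr_var (t : ℕ) (i z : ℤ) : (σ.setArr t i z).var = σ.var := rfl
@[simp] theorem setArr_tape (t : ℕ) (i z : ℤ) : (σ.setArr t i z).tape = σ.tape := rfl
@[simp] theorem setArr_arr (t u : ℕ) (i z : ℤ) :
    (σ.setArr t i z).arr u = if u = t then Function.update (σ.arr t) i z else σ.arr u := by
  simp [setArr, Function.update_apply]
@[simp] theorem read_var (τ : Tape) (v u : ℕ) :
    (σ.read τ v).var u = if u = v then readValue (σ.tape τ) else σ.var u := by
  simp [read]
@[simp] theorem read_arr (τ : Tape) (v : ℕ) : (σ.read τ v).arr = σ.arr := rfl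
@[simp] theorem read_tape (τ τ' : Tape) (v : ℕ) :
    (σ.read τ v).tape τ' = if τ' = τ then (σ.tape τ).tail else σ.tape τ' := by
  simp [read, Function.update_apply]

end State

namespace Cmd

/-- The variables to which a command may write. -/
def vars : Cmd → List ℕ
  | skip => []
  | assign v _ => [v]
  | store _ _ _ => []
  | read _ v => [v]
  | seq c c' => c.vars ++ c'.vars
  | ite _ c c' => c.vars ++ c'.vars
  | .loop _ c => c.vars

/-- The arrays to which a command may write. -/
def arrs : Cmd → List ℕ
  | skip => []
  | assign _ _ => []
  | store t _ _ => [t]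
  | read _ _ => []
  | seq c c' => c.arrs ++ c'.arrs
  | ite _ c c' => c.arrs ++ c'.arrs
  | .loop _ c => c.arrs

/-- The tapes that a command may read. -/
def tapes : Cmd → List Tape
  | skip => []
  | assign _ _ => []
  | store _ _ _ => []
  | read τ _ => [τ]
  | seq c c' => c.tapes ++ c'.tapes
  | ite _ c c' => c.tapes ++ c'.tapes
  | .loop _ c => c.tapes

end Cmd

/-- `σ'` differs from `σ` only in what the command `c` may change. -/
structure Frame (c : Cmd) (σ σ' : State) : Prop where
  var : ∀ v, v ∉ c.vars → σ'.var v = σ.var v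
  arr : ∀ t, t ∉ c.arrs → σ'.arr t = σ.arr t
  tape : ∀ τ, τ ∉ c.tapes → σ'.tape τ = σ.tape τ

theorem Frame.refl (c : Cmd) (σ : State) : Frame c σ σ :=
  ⟨fun _ _ => rfl, fun _ _ => rfl, fun _ _ => rfl⟩

theorem Frame.mono {c c' : Cmd} {σ σ' : State} (h : Frame c σ σ') (hv : c.vars ⊆ c'.vars)
    (ha : c.arrs ⊆ c'.arrs) (ht : c.tapes ⊆ c'.tapes) : Frame c' σ σ' :=
  ⟨fun v hv' => h.var v fun h' => hv' (hv h'), fun v hv' => h.arr v fun h' => hv' (ha h'),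
    fun v hv' => h.tape v fun h' => hv' (ht h')⟩

theorem Frame.trans {c : Cmd} {σ σ' σ'' : State} (h : Frame c σ σ') (h' : Frame c σ' σ'') :
    Frame c σ σ'' :=
  ⟨fun v hv => (h'.var v hv).trans (h.var v hv), fun v hv => (h'.arr v hv).trans (h.arr v hv),
    fun v hv => (h'.tape v hv).trans (h.tape v hv)⟩

/-- Thanks to this, specifications and loop invariants need not mention what a command never writes.
-/
theorem Exec.frame {N : ℕ} {c : Cmd} {σ σ' : State} {t : ℕ} (h : Exec N c σ σ' t) :
    Frame c σ σ' := by
  induction h with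
  | skip => exact .refl _ _
  | assign h => exact ⟨by simp [Cmd.vars]; tauto, by simp, by simp⟩
  | store h => exact ⟨by simp, by simp [Cmd.arrs]; tauto, by simp⟩
  | read τ v σ => exact ⟨by simp [Cmd.vars]; tauto, by simp, by simp [Cmd.tapes]; tauto⟩
  | seq _ _ ih ih' =>
    exact (ih.mono (by simp [Cmd.vars]) (by simp [Cmd.arrs]) (by simp [Cmd.tapes])).trans
      (ih'.mono (by simp [Cmd.vars]) (by simp [Cmd.arrs]) (by simp [Cmd.tapes]))
  | ite_pos _ _ ih => exact ih.mono (by simp [Cmd.vars]) (by simp [Cmd.arrs]) (by simp [Cmd.tapes])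
  | ite_neg _ _ ih => exact ih.mono (by simp [Cmd.vars]) (by simp [Cmd.arrs]) (by simp [Cmd.tapes])
  | loop_pos _ _ _ ih ih' =>
    exact (ih.mono (by simp [Cmd.vars]) (by simp [Cmd.arrs]) (by simp [Cmd.tapes])).trans ih'
  | loop_neg => exact .refl _ _

/-- Started in `σ`, the command `c` stops after at most `T` steps, in a state that satisfies `Q`,
and all the numbers that it writes have absolute value at most `N`. -/
def Wp (N : ℕ) (c : Cmd) (T : ℕ) (Q : State → Prop) (σ : State) : Prop :=
  ∃ σ' t, Exec N c σ σ' t ∧ t ≤ T ∧ Q σ'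

theorem Wp.mono {N : ℕ} {c : Cmd} {T T' : ℕ} {Q Q' : State → Prop} {σ : State}
    (h : Wp N c T Q σ) (hT : T ≤ T') (hQ : ∀ σ', Frame c σ σ' → Q σ' → Q' σ') :
    Wp N c T' Q' σ := by
  obtain ⟨σ', t, hx, ht, hq⟩ := h
  exact ⟨σ', t, hx, ht.trans hT, hQ σ' hx.frame hq⟩

theorem Wp.seq {N : ℕ} {c c' : Cmd} {T T' T'' : ℕ} {P Q : State → Prop} {σ : State}
    (h : Wp N c T P σ) (h' : ∀ σ', Frame c σ σ' → P σ' → Wp N c' T' Q σ')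
    (hT : T + T' ≤ T'') : Wp N (c ;; c') T'' Q σ := by
  obtain ⟨σ', t, hx, ht, hp⟩ := h
  obtain ⟨σ'', t', hx', ht', hq⟩ := h' σ' hx.frame hp
  exact ⟨σ'', _, .seq hx hx', by omega, hq⟩

/-- The invariant is indexed by the number of completed iterations, and it has to show `i < K`
whenever the condition still holds. Termination and the step count then follow by induction on `K -
i`. -/
theorem Wp.loop {N : ℕ} {e : Expr} {c : Cmd} (I : ℕ → State → Prop) (K T : ℕ)
    {Q : State → Prop} {σ₀ : State} (h0 : I 0 σ₀)
    (hstep : ∀ i σ, I i σ → Frame c σ₀ σ → 0 < e.eval σ → i < K ∧ Wp N c T (I (i + 1)) σ)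
    (hQ : ∀ i σ, I i σ → Frame c σ₀ σ → e.eval σ ≤ 0 → Q σ) :
    Wp N (.loop e c) (K * (T + 1) + 1) Q σ₀ := by
  have key : ∀ k i σ, I i σ → Frame c σ₀ σ → i + k = K →
      Wp N (.loop e c) (k * (T + 1) + 1) Q σ := by
    intro k
    induction k with
    | zero =>
      intro i σ hi hf hk
      by_cases he : 0 < e.eval σ
      · have := (hstep i σ hi hf he).1
        omega
      · exact ⟨σ, 1, .loop_neg he, by omega, hQ i σ hi hf (not_lt.1 he)⟩
    | succ k ih =>
      intro i σ hi hf hk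
      by_cases he : 0 < e.eval σ
      · obtain ⟨σ', t, hx, ht, hi'⟩ := (hstep i σ hi hf he).2
        obtain ⟨σ'', t', hx', ht', hq⟩ := ih (i + 1) σ' hi' (hf.trans hx.frame) (by omega)
        exact ⟨σ'', _, .loop_pos he hx hx', by rw [add_mul]; omega, hq⟩
      · exact ⟨σ, 1, .loop_neg he, by omega, hQ i σ hi hf (not_lt.1 he)⟩
  exact key K 0 σ₀ h0 (.refl _ _) (by omega)

namespace Cmd

/-- The verification condition of a command without loops. -/
def vc (N : ℕ) : Cmd → (State → Prop) → State → Prop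
  | skip, Q, σ => Q σ
  | assign v e, Q, σ => |e.eval σ| ≤ N ∧ Q (σ.setVar v (e.eval σ))
  | store t i e, Q, σ => |e.eval σ| ≤ N ∧ Q (σ.setArr t (i.eval σ) (e.eval σ))
  | read τ v, Q, σ => Q (σ.read τ v)
  | seq c c', Q, σ => c.vc N (c'.vc N Q) σ
  | ite e c c', Q, σ => (0 < e.eval σ → c.vc N Q σ) ∧ (e.eval σ ≤ 0 → c'.vc N Q σ)
  | .loop _ _, _, _ => False

/-- A bound on the number of steps of a command without loops. -/
def size : Cmd → ℕ
  | skip => 0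
  | assign _ _ => 1
  | store _ _ _ => 1
  | read _ _ => 1
  | seq c c' => c.size + c'.size
  | ite _ c c' => c.size + c'.size + 1
  | .loop _ _ => 0

/-- The size `0` given to loops is harmless, since their verification condition is `False`. -/
theorem wp_of_vc {N : ℕ} {c : Cmd} {Q : State → Prop} {σ : State} (h : c.vc N Q σ) :
    Wp N c c.size Q σ := by
  induction c generalizing Q σ with
  | skip => exact ⟨σ, 0, .skip σ, le_rfl, h⟩
  | assign v e => exact ⟨_, 1, .assign h.1, le_rfl, h.2⟩
  | store t i e => exact ⟨_, 1, .store h.1, le_rfl, h.2⟩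
  | read τ v => exact ⟨_, 1, .read τ v σ, le_rfl, h⟩
  | seq c c' ih ih' => exact (ih h).seq (fun σ' _ h' => ih' h') le_rfl
  | ite e c c' ih ih' =>
    by_cases he : 0 < e.eval σ
    · obtain ⟨σ', t, hx, ht, hq⟩ := ih (h.1 he)
      exact ⟨σ', _, .ite_pos he hx, by simp only [size]; omega, hq⟩
    · obtain ⟨σ', t, hx, ht, hq⟩ := ih' (h.2 (not_lt.1 he))
      exact ⟨σ', _, .ite_neg he hx, by simp only [size]; omega, hq⟩
  | loop e c => exact h.elim

end Cmd

/-! ### Reading the instance -/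

open ArthurMerlin.Expr (const var arr) in
/-- Read the code of a natural number into the variable `4`. -/
def readNat : Cmd :=
  (.assign 4 (const 0) ;; .assign 3 (const 1) ;; .read .input 1) ;;
    .loop (var 1) (.read .input 2 ;; .assign 4 (var 4 + var 2 * var 3) ;;
      .assign 3 (const 2 * var 3) ;; .read .input 1)

open ArthurMerlin.Expr (const var arr) in
/-- Read the code of an integer into the variable `4`. -/
def readInt : Cmd :=
  .read .input 5 ;; readNat ;; .ite (var 5) (.assign 4 (const 0 - var 4)) .skip

open ArthurMerlin.Expr (const var arr) in
/-- Read `4 * n` integers into the array `0`, where `n` is the value of the variable `0`. -/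
def readInts : Cmd :=
  .assign 6 (const 0) ;;
    .loop (const 4 * var 0 - var 6) (readInt ;; .store 0 (var 6) (var 4) ;;
      .assign 6 (var 6 + const 1))

theorem readValue_cons (b : Bool) (l : List Bool) : readValue (b :: l) = b.toNat := by
  cases b <;> rfl

def ofBits : List Bool → ℕ
  | [] => 0
  | b :: l => b.toNat + 2 * ofBits l

theorem ofBits_bits (n : ℕ) : ofBits n.bits = n := by
  have h := Nat.ofDigits_digits 2 n
  rw [Nat.digits_two_eq_bits] at h
  have key : ∀ l : List Bool, Nat.ofDigits 2 (l.map fun b => cond b 1 0) = ofBits l := by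
    intro l
    induction l with
    | nil => rfl
    | cons b l ih => cases b <;> simp [ofBits, Nat.ofDigits_cons, ih]
  rw [← key]; exact h

theorem two_pow_size_le (n : ℕ) : 2 ^ n.size ≤ 2 * n + 1 := by
  rcases Nat.eq_zero_or_pos n with rfl | h
  · simp
  · obtain ⟨k, hk⟩ : ∃ k, n.size = k + 1 := ⟨n.size - 1, by have := Nat.size_pos.2 h; omega⟩
    have : 2 ^ k ≤ n := Nat.lt_size.1 (by omega)
    rw [hk, pow_succ]; omega

/-- The bound has to be `2 * m + 1` rather than `m`, because the variable `3` ends as a power of two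
that exceeds `m`. -/
theorem wp_readNat {N m : ℕ} {σ : State} {u : List Bool} (hσ : σ.tape .input = encodeNat m ++ u)
    (hN : 2 * m + 1 ≤ N) :
    Wp N readNat (5 * m.size + 4) (fun σ' => σ'.var 4 = m ∧ σ'.tape .input = u) σ := by
  have h2 := two_pow_size_le m
  have hN1 : (1 : ℤ) ≤ N := by omega
  refine Wp.seq (T := 3) (T' := m.size * (4 + 1) + 1)
    (P := fun σ' => σ'.var 4 = 0 ∧ σ'.var 3 = 1 ∧ σ'.var 1 = readValue (encodeNat m ++ u) ∧
      σ'.tape .input = (encodeNat m ++ u).tail) ?_ ?_ (by omega)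
  · exact Cmd.wp_of_vc (by simp [Cmd.vc, hσ, hN1])
  rintro σ₀ - ⟨h4, h3, h1, ht⟩
  -- Here `l` consists of the digits still to be read. The marker bit in front of them has already
  -- been read into the variable `1`, hence the `tail`.
  refine Wp.loop (fun i σ => ∃ l : List Bool, l.length + i = m.size ∧ 0 ≤ σ.var 4 ∧
    σ.var 4 + 2 ^ i * ofBits l = m ∧ σ.var 3 = 2 ^ i ∧
    σ.var 1 = readValue ((l.flatMap fun b => [true, b]) ++ [false] ++ u) ∧
    σ.tape .input = ((l.flatMap fun b => [true, b]) ++ [false] ++ u).tail) _ _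
    ⟨m.bits, by rw [← Nat.size_eq_bits_len, add_zero], by rw [h4],
      by simp [h4, ofBits_bits], by simpa using h3, h1, ht⟩ ?_ ?_
  · rintro i σ ⟨l, hl, h0, hv, h3, h1, ht⟩ - he
    rcases l with _ | ⟨b, l⟩
    · simp [readValue] at h1
      simp [h1] at he
    refine ⟨by simp at hl; omega, Cmd.wp_of_vc ?_⟩
    have ht' : σ.tape .input = b :: (l.flatMap fun b => [true, b]) ++ [false] ++ u := by
      simpa using ht
    simp only [ofBits] at hv
    push_cast at hv
    have hp : (0 : ℤ) < 2 ^ i := by positivity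
    have hpow : (2 : ℤ) * 2 ^ i ≤ N := by
      have : 2 ^ (i + 1) ≤ 2 ^ m.size := Nat.pow_le_pow_right (by norm_num) (by simp at hl; omega)
      rw [← pow_succ']
      exact_mod_cast (this.trans h2).trans hN
    have hq : (0 : ℤ) ≤ 2 ^ i * (ofBits l : ℤ) := by positivity
    have hq' : (0 : ℤ) ≤ (b.toNat : ℤ) * 2 ^ i := by positivity
    simp only [Cmd.vc, State.read_var, State.setVar_var, State.setVar_tape, State.read_tape,
      if_true, Expr.eval_add, Expr.eval_mul,
      Expr.eval_var, Expr.eval_const, ht', readValue_cons, h3, Nat.reduceEqDiff, if_false,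
      List.cons_append, List.tail_cons]
    refine ⟨?_, ?_, l, by simp at hl; omega, by linarith, ?_, by rw [pow_succ'], ?_, ?_⟩
    · rw [abs_of_nonneg (by linarith)]
      have : (m : ℤ) ≤ N := by omega
      linarith
    · rw [abs_of_nonneg (by linarith)]; exact hpow
    · rw [pow_succ]; linarith
    · trivial
    · trivial
  · rintro i σ ⟨l, hl, h0, hv, h3, h1, ht⟩ - he
    rcases l with _ | ⟨b, l⟩
    · simp [ofBits] at hv ht
      exact ⟨hv, ht⟩
    · simp [readValue] at h1
      simp [h1] at he

theorem wp_readInt {N : ℕ} {z : ℤ} {σ : State} {u : List Bool}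
    (hσ : σ.tape .input = encodeInt z ++ u) (hN : 2 * z.natAbs + 1 ≤ N) :
    Wp N readInt (5 * z.natAbs.size + 7) (fun σ' => σ'.var 4 = z ∧ σ'.tape .input = u) σ := by
  refine Wp.seq (T := 1) (T' := 5 * z.natAbs.size + 6)
    (P := fun σ' => σ'.var 5 = (decide (z < 0)).toNat ∧
      σ'.tape .input = encodeNat z.natAbs ++ u) ?_ ?_ (by omega)
  · refine Cmd.wp_of_vc ?_
    simp [Cmd.vc, hσ, encodeInt, readValue_cons]
  rintro σ₁ - ⟨h5, ht⟩
  refine Wp.seq (wp_readNat ht hN) (T' := 2) ?_ (by omega)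
  rintro σ₂ hf ⟨h4, ht⟩
  refine Cmd.wp_of_vc ?_
  rw [← hf.var 5 (by simp [readNat, Cmd.vars])] at h5
  by_cases hz : z < 0
  · simp [Cmd.vc, h5, h4, hz, ht]; rw [abs_of_neg hz]; omega
  · simp [Cmd.vc, h5, h4, hz, ht]; omega

theorem wp_readInts {N n s : ℕ} {Z : List ℤ} {σ : State} (hn : σ.var 0 = n)
    (hZ : Z.length = 4 * n) (hσ : σ.tape .input = Z.flatMap encodeInt)
    (hN : ∀ z ∈ Z, 2 * z.natAbs + 1 ≤ N) (hs : ∀ z ∈ Z, z.natAbs.size ≤ s) (hnN : 4 * n ≤ N) :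
    Wp N readInts (4 * n * (5 * s + 10) + 2)
      (fun σ' => ∀ k (hk : k < Z.length), σ'.arr 0 k = Z[k]) σ := by
  refine Wp.seq (T := 1) (T' := 4 * n * ((5 * s + 9) + 1) + 1)
    (P := fun σ' => σ'.var 6 = 0 ∧ σ'.tape .input = Z.flatMap encodeInt) ?_ ?_
    (by rw [show 5 * s + 9 + 1 = 5 * s + 10 from rfl]; omega)
  · exact Cmd.wp_of_vc (by simp [Cmd.vc, hσ])
  rintro σ₁ hf₁ ⟨h6, ht⟩
  have hn₁ : σ₁.var 0 = n := by rw [hf₁.var 0 (by simp [Cmd.vars]), hn]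
  refine Wp.loop (fun i σ => i ≤ Z.length ∧ σ.var 6 = i ∧
    σ.tape .input = (Z.drop i).flatMap encodeInt ∧
    ∀ k (hk : k < Z.length), k < i → σ.arr 0 k = Z[k]) _ _ ⟨by simp, by simpa using h6,
      by simpa using ht, by simp⟩ ?_ ?_
  · rintro i σ ⟨hi, h6, ht, ha⟩ hf he
    have hn₂ : σ.var 0 = n := by
      rw [hf.var 0 (by simp [Cmd.vars, readInt, readNat]), hn₁]
    simp [h6, hn₂] at he
    have hi' : i < Z.length := by omega
    refine ⟨by omega, ?_⟩
    rw [List.drop_eq_getElem_cons hi', List.flatMap_cons] at ht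
    have hmem : Z[i] ∈ Z := List.getElem_mem hi'
    refine Wp.seq (wp_readInt ht (hN _ hmem)) (T' := 2) ?_ (by have := hs _ hmem; omega)
    rintro σ₃ hf₃ ⟨h4, ht₃⟩
    refine Cmd.wp_of_vc ?_
    have h6' : σ₃.var 6 = i := by rw [hf₃.var 6 (by simp [Cmd.vars, readInt, readNat]), h6]
    have ha' : σ₃.arr 0 = σ.arr 0 := hf₃.arr 0 (by simp [Cmd.arrs, readInt, readNat])
    simp only [Cmd.vc, Expr.eval_var, h4, h6', Expr.eval_add, Expr.eval_const, State.setArr_var,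
      State.setVar_var, if_true, State.setVar_tape, State.setArr_tape, State.setVar_arr,
      State.setArr_arr, ht₃]
    have := hN _ hmem
    refine ⟨by rw [abs_le]; omega, by rw [abs_le]; omega, hi', by push_cast; rfl, trivial, fun k
        hk hki => ?_⟩
    rcases Nat.lt_succ_iff_lt_or_eq.1 hki with h | rfl
    · rw [Function.update_of_ne (by exact_mod_cast h.ne), ha', ha k hk h]
    · simp
  · rintro i σ ⟨hi, h6, ht, ha⟩ hf he k hk
    have hn₂ : σ.var 0 = n := by
      rw [hf.var 0 (by simp [Cmd.vars, readInt, readNat]), hn₁]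
    simp [h6, hn₂] at he
    exact ha k hk (by omega)

/-! ### Reading the coins and the proof -/

/-- The number given by the first `k` bits that are read from a tape. -/
def bitsValue (l : List Bool) : ℕ → ℤ
  | 0 => 0
  | k + 1 => 2 * bitsValue l k + readValue (l.drop k)

/-- This holds for short tapes as well: an exhausted tape yields the digit `-1`. Running time and
soundness therefore require nothing of the length of the proof. -/
theorem abs_bitsValue_lt (l : List Bool) (k : ℕ) : |bitsValue l k| < 2 ^ k := by
  induction k with
  | zero => simp [bitsValue]
  | succ k ih =>
    have := abs_readValue_le (l.drop k)
    rw [abs_lt] at ih ⊢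
    rw [abs_le] at this
    simp only [bitsValue, pow_succ]
    omega

open ArthurMerlin.Expr (const var arr) in
/-- Compute the bound `C * n ^ e` into the variable `7`, where `n` is the value of the
variable `0`. -/
def computeBound (C e : ℕ) : Cmd :=
  (.assign 7 (const C) ;; .assign 6 (const e)) ;;
    .loop (var 6) (.assign 7 (var 7 * var 0) ;; .assign 6 (var 6 - const 1))

open ArthurMerlin.Expr (const var arr) in
/-- Choose a power of two greater than `4 * B`, where `B` is the value of the variable `7`, and read
as many coins. -/
def readCoins : Cmd :=
  (.assign 8 (const 1) ;; .assign 11 (const 0)) ;;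
    .loop (const 4 * var 7 + const 1 - var 8) (.assign 8 (const 2 * var 8) ;; .read .coins 2 ;;
      .assign 11 (const 2 * var 11 + var 2))

open ArthurMerlin.Expr (const var arr) in
/-- Compute the greatest power of two that is at most `n`, and read as many coins and proof bits. -/
def readProof : Cmd :=
  (.assign 9 (const 1) ;; .assign 10 (var 8) ;; .assign 12 (const 0)) ;;
    .loop (var 0 + const 1 - const 2 * var 9) (.assign 9 (const 2 * var 9) ;;
      .assign 10 (const 2 * var 10) ;; .read .coins 2 ;; .assign 11 (const 2 * var 11 + var 2) ;;
      .read .proof 2 ;; .assign 12 (const 2 * var 12 + var 2))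

theorem wp_computeBound {N n C e : ℕ} {σ : State} (hn : σ.var 0 = n)
    (hC : ∀ i ≤ e, C * n ^ i ≤ N) (he : e ≤ N) :
    Wp N (computeBound C e) (3 * e + 3) (fun σ' => σ'.var 7 = (C * n ^ e : ℕ)) σ := by
  refine Wp.seq (T := 2) (T' := e * (2 + 1) + 1)
    (P := fun σ' => σ'.var 7 = C ∧ σ'.var 6 = e) ?_ ?_ (by omega)
  · refine Cmd.wp_of_vc ?_
    have := hC 0 (Nat.zero_le _)
    simp only [pow_zero, mul_one] at this
    simp [Cmd.vc, he, this]
  rintro σ₁ hf₁ ⟨h7, h6⟩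
  have hn₁ : σ₁.var 0 = n := by rw [hf₁.var 0 (by simp [Cmd.vars]), hn]
  refine Wp.loop (fun i σ => i ≤ e ∧ σ.var 6 = e - i ∧ σ.var 7 = (C * n ^ i : ℕ)) _ _
    ⟨by omega, by simpa using h6, by simpa using h7⟩ ?_ ?_
  · rintro i σ ⟨hi, h6, h7⟩ hf hp
    have hn₂ : σ.var 0 = n := by rw [hf.var 0 (by simp [Cmd.vars]), hn₁]
    simp [h6] at hp
    refine ⟨hp, Cmd.wp_of_vc ?_⟩
    have h1 := hC (i + 1) hp
    have h2 : ((C * n ^ i : ℕ) : ℤ) * n = (C * n ^ (i + 1) : ℕ) := by push_cast; ring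
    simp only [Cmd.vc, Expr.eval_mul, Expr.eval_var, h7, hn₂, h2, Expr.eval_sub, Expr.eval_const,
      State.setVar_var, Nat.reduceEqDiff, if_false, if_true, h6]
    refine ⟨?_, ?_, hp, by push_cast; ring, trivial⟩
    · rw [abs_of_nonneg (by positivity)]; exact_mod_cast h1
    · rw [abs_le]; omega
  · rintro i σ ⟨hi, h6, h7⟩ hf hp
    simp [h6] at hp
    rw [h7, show i = e by omega]

theorem wp_readCoins {N B : ℕ} {σ : State} {u : List Bool} (hB : σ.var 7 = B)
    (hσ : σ.tape .coins = u) (hN : 8 * B + 1 ≤ N) :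
    Wp N readCoins (4 * (4 * B).size + 3) (fun σ' => σ'.var 8 = 2 ^ (4 * B).size ∧
      σ'.var 11 = bitsValue u (4 * B).size ∧ σ'.tape .coins = u.drop (4 * B).size) σ := by
  have hsz := two_pow_size_le (4 * B)
  refine Wp.seq (T := 2) (T' := (4 * B).size * (3 + 1) + 1)
    (P := fun σ' => σ'.var 8 = 1 ∧ σ'.var 11 = 0 ∧ σ'.tape .coins = u) ?_ ?_ (by omega)
  · exact Cmd.wp_of_vc (by simp [Cmd.vc, hσ]; omega)
  rintro σ₁ hf₁ ⟨h8, h11, ht⟩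
  have hB₁ : σ₁.var 7 = B := by rw [hf₁.var 7 (by simp [Cmd.vars]), hB]
  refine Wp.loop (fun i σ => i ≤ (4 * B).size ∧ σ.var 8 = 2 ^ i ∧ σ.var 11 = bitsValue u i ∧
    σ.tape .coins = u.drop i) _ _ ⟨by omega, by simpa using h8, h11, by simpa using ht⟩ ?_ ?_
  · rintro i σ ⟨hi, h8, h11, ht⟩ hf hp
    have hB₂ : σ.var 7 = B := by rw [hf.var 7 (by simp [Cmd.vars]), hB₁]
    simp [h8, hB₂] at hp
    -- The loop goes on while `2 ^ i ≤ 4 * B`, which says exactly that `i` is less than the binary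
    -- length of `4 * B`.
    have hlt : i < (4 * B).size := Nat.lt_size.2 (by zify; omega)
    refine ⟨hlt, Cmd.wp_of_vc ?_⟩
    have hpow : (2 : ℤ) ^ (i + 1) ≤ N := by
      have : 2 ^ (i + 1) ≤ 2 ^ (4 * B).size := Nat.pow_le_pow_right (by norm_num) hlt
      exact_mod_cast (this.trans hsz).trans (by omega)
    have hb := abs_bitsValue_lt u (i + 1)
    simp only [bitsValue] at hb
    simp only [Cmd.vc, Expr.eval_mul, Expr.eval_var, Expr.eval_const, Expr.eval_add, h8, h11,
      State.setVar_var, State.read_var, State.setVar_tape, State.read_tape, Nat.reduceEqDiff,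
      if_false, if_true, ht]
    refine ⟨?_, by linarith, hlt, by rw [pow_succ'], rfl, by simp⟩
    rw [abs_of_nonneg (by positivity), ← pow_succ']; exact hpow
  · rintro i σ ⟨hi, h8, h11, ht⟩ hf hp
    have hB₂ : σ.var 7 = B := by rw [hf.var 7 (by simp [Cmd.vars]), hB₁]
    simp [h8, hB₂] at hp
    have : (4 * B).size ≤ i := Nat.size_le.2 (by zify; omega)
    rw [show (4 * B).size = i by omega]
    exact ⟨h8, h11, ht⟩

/-- The multiplier already has `m` bits and gets one more at each doubling of `H`; in the end it has
as many bits as `L * H` has factors of two. -/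
theorem wp_readProof {N n m : ℕ} {σ : State} {u v : List Bool} (hn : σ.var 0 = n)
    (h8 : σ.var 8 = 2 ^ m) (h11 : σ.var 11 = bitsValue u m) (hu : σ.tape .coins = u.drop m)
    (hv : σ.tape .proof = v) (hN : 2 ^ m * (n + 1) ≤ N) :
    Wp N readProof (7 * Nat.log 2 n + 4) (fun σ' => σ'.var 9 = 2 ^ Nat.log 2 n ∧
      σ'.var 10 = 2 ^ m * 2 ^ Nat.log 2 n ∧ σ'.var 11 = bitsValue u (m + Nat.log 2 n) ∧
      σ'.var 12 = bitsValue v (Nat.log 2 n)) σ := by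
  have hm : 1 ≤ 2 ^ m := Nat.one_le_two_pow
  have hN1 : 1 ≤ N := by nlinarith
  have hmN : 2 ^ m ≤ N := by nlinarith
  refine Wp.seq (T := 3) (T' := Nat.log 2 n * (6 + 1) + 1)
    (P := fun σ' => σ'.var 9 = 1 ∧ σ'.var 10 = 2 ^ m ∧ σ'.var 12 = 0) ?_ ?_ (by omega)
  · exact Cmd.wp_of_vc (by simp [Cmd.vc, h8]; exact ⟨hN1, by exact_mod_cast hmN⟩)
  rintro σ₁ hf₁ ⟨h9, h10, h12⟩
  have hn₁ : σ₁.var 0 = n := by rw [hf₁.var 0 (by simp [Cmd.vars]), hn]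
  rw [← hf₁.var 11 (by simp [Cmd.vars])] at h11
  rw [← hf₁.tape .coins (by simp [Cmd.tapes])] at hu
  rw [← hf₁.tape .proof (by simp [Cmd.tapes])] at hv
  refine Wp.loop (fun i σ => i ≤ Nat.log 2 n ∧ σ.var 9 = 2 ^ i ∧ σ.var 10 = 2 ^ m * 2 ^ i ∧
    σ.var 11 = bitsValue u (m + i) ∧ σ.var 12 = bitsValue v i ∧
    σ.tape .coins = u.drop (m + i) ∧ σ.tape .proof = v.drop i) _ _
    ⟨by omega, by simpa using h9, by simpa using h10, h11, h12, hu, by simpa using hv⟩ ?_ ?_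
  · rintro i σ ⟨hi, h9, h10, h11, h12, hu, hv⟩ hf hp
    have hn₂ : σ.var 0 = n := by rw [hf.var 0 (by simp [Cmd.vars]), hn₁]
    simp [h9, hn₂] at hp
    have hle : 2 ^ (i + 1) ≤ n := by zify; rw [pow_succ]; omega
    have hlt : i + 1 ≤ Nat.log 2 n := Nat.le_log_of_pow_le (by norm_num) hle
    refine ⟨hlt, Cmd.wp_of_vc ?_⟩
    have hpow : (2 : ℤ) ^ m * 2 ^ (i + 1) ≤ N := by
      have : 2 ^ m * 2 ^ (i + 1) ≤ 2 ^ m * (n + 1) := Nat.mul_le_mul_left _ (by omega)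
      exact_mod_cast this.trans hN
    have hpow' : (2 : ℤ) ^ (i + 1) ≤ N := by
      have : 2 ^ (i + 1) ≤ 2 ^ m * (n + 1) := by nlinarith
      exact_mod_cast this.trans hN
    have hb := abs_bitsValue_lt u (m + i + 1)
    have hb' := abs_bitsValue_lt v (i + 1)
    rw [add_assoc, pow_add, ← add_assoc] at hb
    simp only [bitsValue] at hb hb'
    simp only [Cmd.vc, Expr.eval_mul, Expr.eval_var, Expr.eval_const, Expr.eval_add, h9, h10, h11,
      h12, State.setVar_var, State.read_var, State.setVar_tape, State.read_tape, Nat.reduceEqDiff,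
      if_false, if_true, hu, hv, reduceCtorEq]
    refine ⟨?_, ?_, by linarith, by linarith, hlt, by rw [pow_succ'], by rw [pow_succ']; ring, rfl,
      rfl, by simp [add_assoc], by simp⟩
    · rw [abs_of_nonneg (by positivity), ← pow_succ']; exact hpow'
    · rw [abs_of_nonneg (by positivity)]; rw [pow_succ] at hpow; linarith
  · rintro i σ ⟨hi, h9, h10, h11, h12, hu, hv⟩ hf hp
    have hn₂ : σ.var 0 = n := by rw [hf.var 0 (by simp [Cmd.vars]), hn₁]
    simp [h9, hn₂] at hp
    have hlt : n < 2 ^ (i + 1) := by zify; rw [pow_succ]; omega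
    have : Nat.log 2 n < i + 1 := by
      rcases Nat.eq_zero_or_pos n with rfl | hpos
      · simp
      · exact Nat.log_lt_of_lt_pow (by omega) hlt
    rw [show Nat.log 2 n = i by omega]
    exact ⟨h9, h10, h11, h12⟩


/-! ### Hash buckets -/

/-- The arrays `c` (sizes) and `s` (contents) hold the elements of `Y`, sorted into buckets by the
hash function `h` with values in `{0, …, H - 1}`. -/
structure Buckets (h : ℤ → ℤ) (H : ℤ) (Y : Finset ℤ) (c : ℤ → ℤ) (s : ℤ → ℤ) : Prop where
  size : ∀ k, c k = (Y.filter (h · = k)).card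
  mem : ∀ k i, 0 ≤ k → k < H → 0 ≤ i → i < c k → s (i * H + k) ∈ Y
  exists_index : ∀ y ∈ Y, ∃ i, 0 ≤ i ∧ i < c (h y) ∧ s (i * H + h y) = y

theorem Buckets.insert {h : ℤ → ℤ} {H : ℤ} {Y : Finset ℤ} {c s : ℤ → ℤ} (hb : Buckets h H Y c s)
    (hh : ∀ y, 0 ≤ h y ∧ h y < H) {y : ℤ} (hy : y ∉ Y) :
    Buckets h H (insert y Y) (Function.update c (h y) (c (h y) + 1))
      (Function.update s (c (h y) * H + h y) y) := by
  have hH : 0 < H := (hh y).1.trans_lt (hh y).2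
  have hc : ∀ k, 0 ≤ c k := fun k => by rw [hb.size]; positivity
  -- Slot `i` of bucket `k` is stored at `i * H + k`; quotient and remainder modulo `H` recover
  -- both, so distinct slots do not overlap.
  have key : ∀ {i j k : ℤ}, 0 ≤ k → k < H → i * H + k = j * H + h y → k = h y ∧ i = j := by
    intro i j k h0 h1 he
    have h2 := congrArg (· % H) he
    have h3 : (i * H + k) % H = k := by
      rw [add_comm, Int.add_mul_emod_self_right, Int.emod_eq_of_lt h0 h1]
    have h4 : (j * H + h y) % H = h y := by
      rw [add_comm, Int.add_mul_emod_self_right, Int.emod_eq_of_lt (hh y).1 (hh y).2]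
    simp only [h3, h4] at h2
    exact ⟨h2, mul_right_cancel₀ hH.ne' (by linarith)⟩
  refine ⟨fun k => ?_, fun k i h0 h1 h2 h3 => ?_, fun z hz => ?_⟩
  · rw [Finset.filter_insert]
    by_cases hk : k = h y
    · subst hk
      rw [if_pos rfl, Finset.card_insert_of_notMem (by simp [hy]), Function.update_self, hb.size]
      push_cast; rfl
    · rw [if_neg (fun h' => hk h'.symm), Function.update_of_ne hk, hb.size]
  · by_cases he : i * H + k = c (h y) * H + h y
    · rw [he, Function.update_self]; exact Finset.mem_insert_self _ _
    · rw [Function.update_of_ne he]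
      refine Finset.mem_insert_of_mem (hb.mem k i h0 h1 h2 ?_)
      by_cases hk : k = h y
      · subst hk
        rw [Function.update_self] at h3
        have : i ≠ c (h y) := fun h' => he (by rw [h'])
        omega
      · rwa [Function.update_of_ne hk] at h3
  · rcases Finset.mem_insert.1 hz with rfl | hz
    · exact ⟨c (h z), hc _, by rw [Function.update_self]; omega, by rw [Function.update_self]⟩
    · obtain ⟨i, hi0, hi1, hi2⟩ := hb.exists_index z hz
      refine ⟨i, hi0, ?_, ?_⟩
      · by_cases hk : h z = h y
        · rw [hk, Function.update_self]; rw [hk] at hi1; omega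
        · rwa [Function.update_of_ne hk]
      · rw [Function.update_of_ne, hi2]
        intro he
        obtain ⟨h1, h2⟩ := key (hh z).1 (hh z).2 he
        rw [h1, h2] at hi1
        omega

/-- The upper half of the residue of `a * y` modulo `L * H`. -/
def hash (a L H y : ℤ) : ℤ := (a * y % (L * H)) / L

theorem hash_bounds {L H : ℤ} (hL : 0 < L) (hH : 0 < H) (a y : ℤ) :
    0 ≤ hash a L H y ∧ hash a L H y < H := by
  have h := Int.emod_nonneg (a * y) (mul_pos hL hH).ne'
  have h' := Int.emod_lt_of_pos (a * y) (mul_pos hL hH)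
  exact ⟨Int.ediv_nonneg h hL.le, Int.ediv_lt_of_lt_mul hL (by rw [mul_comm H L]; exact h')⟩

section
open ArthurMerlin.Expr (const var arr)

/-- The value of the hash function at `e`. -/
def hashExpr (e : Expr) : Expr := ((var 11 * e) % var 10) / var 8

/-- Put the distinct elements of the sequence `2 * p + 1` into buckets. -/
def fillBuckets (p : ℕ) : Cmd :=
  .assign 6 (const 0) ;;
    .loop (var 0 - var 6) (.assign 14 (arr 0 (const (2 * p + 1) * var 0 + var 6)) ;;
      .ite (arr (4 * p + 1) (var 14)) .skip
        (.store (4 * p + 1) (var 14) (const 1) ;; .assign 15 (hashExpr (var 14)) ;;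
          .store (4 * p + 3) (arr (4 * p + 2) (var 15) * var 9 + var 15) (var 14) ;;
          .store (4 * p + 2) (var 15) (arr (4 * p + 2) (var 15) + const 1)) ;;
      .assign 6 (var 6 + const 1))

/-- For the elements `x` of the sequence `2 * p`, run through the buckets `e - d - hash x` with
`d < 4`, in at most `6000 * n` steps. Mark the sums that are found, and set the variable `19` if the
opposite sum has been marked before. -/
def scanBuckets (p : ℕ) (e : Expr) : Cmd :=
  (.assign 17 (const 0) ;; .assign 16 (const 0) ;; .assign 18 (const 6000 * var 0)) ;;
    .loop (var 18) (.assign 18 (var 18 - const 1) ;;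
      .ite (const 4 * var 0 - var 17)
        (.assign 13 (arr 0 (const (2 * p) * var 0 + var 17 / const 4)) ;;
          .assign 15 ((e - var 17 % const 4 - hashExpr (var 13)) % var 9) ;;
          .ite (arr (4 * p + 2) (var 15) - var 16)
            (.assign 13 (var 13 + arr (4 * p + 3) (var 16 * var 9 + var 15)) ;;
              .store (4 * p + 8) (var 13) (const 1) ;;
              .ite (arr (4 * p + 4) (const 0 - var 13)) (.assign 19 (const 1)) .skip ;;
              .assign 16 (var 16 + const 1))
            (.assign 16 (const 0) ;; .assign 17 (var 17 + const 1)))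
        .skip)

end

/-- The array `4 * p + 1` marks the values already inserted, so that repeated entries are skipped.
Without this, the pairs with the correct sum could be too numerous for the step budget. -/
theorem wp_fillBuckets {N n p : ℕ} {σ : State} {a L H : ℤ} {Y : ℕ → ℤ} (h0 : σ.var 0 = n)
    (h8 : σ.var 8 = L) (h9 : σ.var 9 = H) (h10 : σ.var 10 = L * H) (h11 : σ.var 11 = a)
    (hL : 0 < L) (hH : 0 < H) (hY : ∀ i < n, σ.arr 0 ((2 * p + 1) * n + i) = Y i)
    (h1 : σ.arr (4 * p + 1) = 0) (h2 : σ.arr (4 * p + 2) = 0) (hYN : ∀ i < n, |Y i| ≤ N)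
    (hnN : n + 1 ≤ N) (hHN : H ≤ N) :
    Wp N (fillBuckets p) (8 * n + 2) (fun σ' => Buckets (hash a L H) H ((Finset.range n).image Y)
      (σ'.arr (4 * p + 2)) (σ'.arr (4 * p + 3))) σ := by
  have hh := hash_bounds hL hH a
  refine Wp.seq (T := 1) (T' := n * (7 + 1) + 1)
    (P := fun σ' => σ'.var 6 = 0) (Cmd.wp_of_vc (by simp [Cmd.vc])) ?_ (by omega)
  rintro σ₁ hf₁ h6
  rw [← hf₁.var 0 (by simp [Cmd.vars])] at h0
  rw [← hf₁.var 8 (by simp [Cmd.vars])] at h8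
  rw [← hf₁.var 9 (by simp [Cmd.vars])] at h9
  rw [← hf₁.var 10 (by simp [Cmd.vars])] at h10
  rw [← hf₁.var 11 (by simp [Cmd.vars])] at h11
  rw [← hf₁.arr _ (by simp [Cmd.arrs])] at h1 h2 hY
  refine Wp.loop (fun i σ => i ≤ n ∧ σ.var 6 = i ∧
    (∀ y, 0 < σ.arr (4 * p + 1) y ↔ y ∈ (Finset.range i).image Y) ∧
    Buckets (hash a L H) H ((Finset.range i).image Y) (σ.arr (4 * p + 2)) (σ.arr (4 * p + 3))) _ _
    ⟨by omega, by simpa using h6, by simp [h1], by simp [h2], by simp [h2], by simp⟩ ?_ ?_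
  · rintro i σ ⟨hi, h6, hm, hb⟩ hf hp
    rw [← hf.var 0 (by simp [Cmd.vars])] at h0
    rw [← hf.var 8 (by simp [Cmd.vars])] at h8
    rw [← hf.var 9 (by simp [Cmd.vars])] at h9
    rw [← hf.var 10 (by simp [Cmd.vars])] at h10
    rw [← hf.var 11 (by simp [Cmd.vars])] at h11
    rw [← hf.arr 0 (by simp [Cmd.arrs])] at hY
    simp [h0, h6] at hp
    have hNi := hYN i hp
    have hr : Finset.image Y (Finset.range (i + 1)) = insert (Y i) ((Finset.range i).image Y) := by
      rw [Finset.range_add_one, Finset.image_insert]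
    refine ⟨hp, Cmd.wp_of_vc ?_⟩
    have hcard : (Finset.image Y (Finset.range i)).card ≤ i :=
      Finset.card_image_le.trans (by simp)
    have hsz := hb.size (hash a L H (Y i))
    have hszN : |σ.arr (4 * p + 2) (hash a L H (Y i)) + 1| ≤ N := by
      rw [hsz]
      have := (Finset.card_filter_le (Finset.image Y (Finset.range i))
        (hash a L H · = hash a L H (Y i))).trans hcard
      rw [abs_le]; omega
    have hhN : |hash a L H (Y i)| ≤ N := by
      rw [abs_of_nonneg (hh _).1]; exact (hh _).2.le.trans hHN
    have hiN : |(i : ℤ) + 1| ≤ N := by rw [abs_le]; omega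
    have h1N : |(1 : ℤ)| ≤ N := by rw [abs_le]; omega
    have hhe : a * Y i % (L * H) / L = hash a L H (Y i) := rfl
    simp only [Cmd.vc, Expr.eval_var, Expr.eval_add, Expr.eval_const, Expr.eval_mul, Expr.eval_arr,
      Expr.eval_div, Expr.eval_mod, hashExpr, h0, h6, h8, h9, h10, h11, hY i hp, State.setArr_var,
      State.setVar_var, if_true, if_false, State.setArr_arr, State.setVar_arr, Nat.reduceEqDiff,
      hNi, true_and, add_right_inj, hhe, hszN, hhN, hiN, h1N]
    refine ⟨fun hpos => ?_, fun hneg => ?_⟩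
    · have hmem := (hm _).1 hpos
      rw [hr, Finset.insert_eq_of_mem hmem]
      exact ⟨by omega, by push_cast; rfl, hm, hb⟩
    · have hmem : Y i ∉ (Finset.range i).image Y := fun h' => by have := (hm _).2 h'; omega
      rw [hr]
      refine ⟨by omega, by push_cast; rfl, fun y => ?_, hb.insert hh hmem⟩
      by_cases hy : y = Y i
      · subst hy; simp
      · rw [Function.update_of_ne hy, hm, Finset.mem_insert]; tauto
  · rintro i σ ⟨hi, h6, hm, hb⟩ hf hp
    rw [← hf.var 0 (by simp [Cmd.vars])] at h0
    simp [h0, h6] at hp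
    rw [show n = i by omega]
    exact hb

/-- The value `v` is among those that are visited before position `s` of row `j`, where row `j` has
`cnt j` entries `val j 0, val j 1, …`. -/
def Visited (cnt : ℕ → ℕ) (val : ℕ → ℕ → ℤ) (j s : ℕ) (v : ℤ) : Prop :=
  ∃ j' s', (j' < j ∨ j' = j ∧ s' < s) ∧ s' < cnt j' ∧ v = val j' s'

theorem visited_zero (cnt : ℕ → ℕ) (val : ℕ → ℕ → ℤ) (v : ℤ) : ¬ Visited cnt val 0 0 v := by
  rintro ⟨j', s', h, -⟩; omega

theorem visited_succ {cnt : ℕ → ℕ} {val : ℕ → ℕ → ℤ} {j s : ℕ} (hs : s < cnt j) (v : ℤ) :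
    Visited cnt val j (s + 1) v ↔ v = val j s ∨ Visited cnt val j s v := by
  constructor
  · rintro ⟨j', s', h, h', rfl⟩
    by_cases he : j' = j ∧ s' = s
    · obtain ⟨rfl, rfl⟩ := he; exact Or.inl rfl
    · exact Or.inr ⟨j', s', by omega, h', rfl⟩
  · rintro (rfl | ⟨j', s', h, h', rfl⟩)
    · exact ⟨j, s, by omega, hs, rfl⟩
    · exact ⟨j', s', by omega, h', rfl⟩

theorem visited_next {cnt : ℕ → ℕ} {val : ℕ → ℕ → ℤ} {j s : ℕ} (hs : cnt j ≤ s) (v : ℤ) :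
    Visited cnt val (j + 1) 0 v ↔ Visited cnt val j s v := by
  constructor
  · rintro ⟨j', s', h, h', rfl⟩
    refine ⟨j', s', ?_, h', rfl⟩
    rcases Nat.lt_or_ge j' j with h2 | h2
    · exact Or.inl h2
    · obtain rfl : j' = j := by omega
      exact Or.inr ⟨rfl, h'.trans_le hs⟩
  · rintro ⟨j', s', h, h', rfl⟩
    exact ⟨j', s', by omega, h', rfl⟩

/-- The pair `(j, s)` is the final position of the cursor: row `j` stands for the element `j / 4`
with shift `d = j % 4`, and `s` is a slot in its bucket. The scan either finishes all `4 * n` rows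
or uses up its budget. -/
theorem wp_scanBuckets {N n p : ℕ} {e : Expr} {σ : State} {a L H c f : ℤ} {X : ℕ → ℤ}
    {Y : Finset ℤ} {C S I : ℤ → ℤ} (h0 : σ.var 0 = n) (h8 : σ.var 8 = L) (h9 : σ.var 9 = H)
    (h10 : σ.var 10 = L * H) (h11 : σ.var 11 = a) (h19 : σ.var 19 = f)
    (he : ∀ σ' : State, σ'.var 12 = σ.var 12 → e.eval σ' = c) (hH : 0 < H)
    (hX : ∀ i < n, σ.arr 0 (2 * p * n + i) = X i) (h2 : σ.arr (4 * p + 2) = C)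
    (h3 : σ.arr (4 * p + 3) = S) (h4 : σ.arr (4 * p + 4) = I) (h5 : σ.arr (4 * p + 8) = 0)
    (hb : Buckets (hash a L H) H Y C S) (hXN : ∀ i < n, |X i| ≤ N)
    (hXYN : ∀ i < n, ∀ y ∈ Y, |X i + y| ≤ N) (hnN : 6000 * n + 1 ≤ N) (hHN : H ≤ N)
    (hYN : Y.card ≤ N) {key : ℕ → ℤ} (hkey : ∀ j, key j = (c - j % 4 - hash a L H (X (j / 4))) % H)
    {cnt : ℕ → ℕ} (hcnt : ∀ j, cnt j = (Y.filter (hash a L H · = key j)).card)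
    {val : ℕ → ℕ → ℤ} (hval : ∀ j s, val j s = X (j / 4) + S (s * H + key j)) :
    Wp N (scanBuckets p e) (6000 * n * 13 + 4) (fun σ' => ∃ j s, j ≤ 4 * n ∧ (j = 4 * n → s = 0) ∧
      (j = 4 * n ∨ s ≤ cnt j ∧ 6000 * n ≤ ∑ j' ∈ Finset.range j, (cnt j' + 1) + s) ∧
      (∀ v, 0 < σ'.arr (4 * p + 8) v ↔ Visited cnt val j s v) ∧
      (0 < σ'.var 19 ↔ 0 < f ∨ ∃ v, Visited cnt val j s v ∧ 0 < I (-v))) σ := by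
  have hhash : ∀ x, a * x % (L * H) / L = hash a L H x := fun _ => rfl
  refine Wp.seq (T := 3) (T' := 6000 * n * (12 + 1) + 1)
    (P := fun σ' => σ'.var 17 = 0 ∧ σ'.var 16 = 0 ∧ σ'.var 18 = 6000 * n) ?_ ?_ (by omega)
  · refine Cmd.wp_of_vc ?_
    simp only [Cmd.vc, Expr.eval_const, Expr.eval_mul, Expr.eval_var, State.setVar_var, if_true,
      if_false, Nat.reduceEqDiff, h0, and_self, and_true, OfNat.zero_ne_ofNat]
    refine ⟨by simp, by simp, by rw [abs_le]; omega⟩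
  rintro σ₁ hf₁ ⟨h17, h16, h18⟩
  rw [← hf₁.var 0 (by simp [Cmd.vars])] at h0
  rw [← hf₁.var 8 (by simp [Cmd.vars])] at h8
  rw [← hf₁.var 9 (by simp [Cmd.vars])] at h9
  rw [← hf₁.var 10 (by simp [Cmd.vars])] at h10
  rw [← hf₁.var 11 (by simp [Cmd.vars])] at h11
  rw [← hf₁.var 12 (by simp [Cmd.vars])] at he
  rw [← hf₁.var 19 (by simp [Cmd.vars])] at h19
  rw [← hf₁.arr _ (by simp [Cmd.arrs])] at h2 h3 h4 h5 hX
  -- Until the rows are finished, every step either visits an entry or closes a bucket, so `i` is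
  -- the number of visited entries plus the number of closed buckets.
  refine Wp.loop (fun i σ => σ.var 18 = (6000 * n : ℕ) - i ∧ ∃ j s : ℕ, σ.var 17 = j ∧
    σ.var 16 = s ∧ j ≤ 4 * n ∧ (j = 4 * n → s = 0) ∧
    (j = 4 * n ∨ s ≤ cnt j ∧ i = ∑ j' ∈ Finset.range j, (cnt j' + 1) + s) ∧
    (∀ v, 0 < σ.arr (4 * p + 8) v ↔ Visited cnt val j s v) ∧
    (0 < σ.var 19 ↔ 0 < f ∨ ∃ v, Visited cnt val j s v ∧ 0 < I (-v))) _ _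
    ⟨by rw [h18]; push_cast; ring, 0, 0, h17, h16, by omega, fun _ => rfl, by simp,
      by simp [h5, visited_zero], by simp [h19, visited_zero]⟩ ?_ ?_
  · rintro i σ ⟨h18, j, s, h17, h16, hj, hjs, hpos, hout, hfnd⟩ hf hp
    rw [← hf.var 0 (by simp [Cmd.vars])] at h0
    rw [← hf.var 8 (by simp [Cmd.vars])] at h8
    rw [← hf.var 9 (by simp [Cmd.vars])] at h9
    rw [← hf.var 10 (by simp [Cmd.vars])] at h10
    rw [← hf.var 11 (by simp [Cmd.vars])] at h11
    rw [← hf.var 12 (by simp [Cmd.vars])] at he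
    rw [← hf.arr _ (by simp [Cmd.arrs])] at h2 h3 h4 hX
    rw [Expr.eval_var, h18] at hp
    have hi : i < 6000 * n := by omega
    have h18N : |((6000 * n : ℕ) : ℤ) - i - 1| ≤ N := by rw [abs_le]; omega
    have h1N : |(1 : ℤ)| ≤ N := by rw [abs_le]; omega
    have h0N : |(0 : ℤ)| ≤ N := by simp
    refine ⟨hi, Cmd.wp_of_vc ?_⟩
    simp only [Cmd.vc, Expr.eval_var, Expr.eval_add, Expr.eval_sub, Expr.eval_const, Expr.eval_mul,
      Expr.eval_arr, Expr.eval_div, Expr.eval_mod, hashExpr, h0, h8, h9, h10, h11, h16, h17,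
      h18, State.setArr_var, State.setVar_var, if_true, if_false, State.setArr_arr,
      State.setVar_arr, Nat.reduceEqDiff, add_right_inj, h18N, h1N, h0N, true_and,
      OfNat.zero_ne_ofNat]
    refine ⟨fun hj' => ?_, fun hj' => ?_⟩
    swap
    · exact ⟨by push_cast; ring, j, s, rfl, rfl, hj, hjs, Or.inl (by omega), hout, hfnd⟩
    have hj4 : j < 4 * n := by omega
    have hjX : σ.arr 0 (2 * p * n + (j : ℤ) / 4) = X (j / 4) := by
      have := hX (j / 4) (by omega)
      push_cast at this
      exact this
    have hev := he ((σ.setVar 18 (↑(6000 * n) - ↑i - 1)).setVar 13 (X (j / 4)))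
      (by simp [hf.var 12 (by simp [Cmd.vars])])
    have hCk : C (key j) = cnt j := by rw [hb.size, hcnt]
    have hk0 : 0 ≤ key j := by rw [hkey]; exact Int.emod_nonneg _ hH.ne'
    have hkH : key j < H := by rw [hkey]; exact Int.emod_lt_of_pos _ hH
    have hkN : |key j| ≤ N := by rw [abs_of_nonneg hk0]; exact hkH.le.trans hHN
    have hcY : cnt j ≤ Y.card := by rw [hcnt]; exact Finset.card_filter_le _ _
    have hXj := hXN (j / 4) (by omega)
    simp only [hjX, h2, h3, h4, hev, hhash, ← hkey, hCk, ← hval, zero_sub, hXj, hkN, true_and]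
    obtain ⟨hs, hi'⟩ : s ≤ cnt j ∧ i = ∑ j' ∈ Finset.range j, (cnt j' + 1) + s :=
      hpos.resolve_left (by omega)
    have hsub : ((6000 * n : ℕ) : ℤ) - i - 1 = (6000 * n : ℕ) - (i + 1 : ℕ) := by push_cast; ring
    refine ⟨fun hlt => ?_, fun hge => ?_⟩
    · have hlt : s < cnt j := by omega
      have hvN : |val j s| ≤ N := by
        rw [hval]
        exact hXYN _ (by omega) _ (hb.mem _ _ hk0 hkH (by omega) (by omega))
      have hsN : |(s : ℤ) + 1| ≤ N := by rw [abs_le]; omega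
      have hout' : ∀ v, 0 < Function.update (σ.arr (4 * p + 8)) (val j s) 1 v ↔
          Visited cnt val j (s + 1) v := by
        intro v
        rw [visited_succ hlt]
        by_cases hv : v = val j s
        · simp [hv]
        · simp [hv, hout]
      have hpos' : j = 4 * n ∨
          s + 1 ≤ cnt j ∧ i + 1 = ∑ j' ∈ Finset.range j, (cnt j' + 1) + (s + 1) :=
        Or.inr ⟨hlt, by omega⟩
      refine ⟨hvN, fun hI => ?_, fun hI => ?_⟩
      · refine ⟨hsN, hsub, j, s + 1, rfl, by push_cast; rfl, hj, by omega, hpos', hout', ?_⟩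
        exact iff_of_true one_pos (Or.inr ⟨val j s, (visited_succ hlt _).2 (Or.inl rfl), hI⟩)
      · refine ⟨hsN, hsub, j, s + 1, rfl, by push_cast; rfl, hj, by omega, hpos', hout', ?_⟩
        rw [hfnd]
        refine or_congr_right ⟨fun ⟨v, hv, hv'⟩ => ⟨v, (visited_succ hlt _).2 (Or.inr hv), hv'⟩, ?_⟩
        rintro ⟨v, hv, hv'⟩
        rcases (visited_succ hlt v).1 hv with rfl | hv
        · omega
        · exact ⟨v, hv, hv'⟩
    · have hge : cnt j ≤ s := by omega
      refine ⟨by rw [abs_le]; omega, hsub, j + 1, 0, by push_cast; rfl, rfl, hj4, fun _ => rfl,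
        Or.inr ⟨Nat.zero_le _, by rw [Finset.sum_range_succ]; omega⟩, ?_, ?_⟩
      · simpa only [visited_next hge] using hout
      · simpa only [visited_next hge] using hfnd
  · rintro i σ ⟨h18, j, s, h17, h16, hj, hjs, hpos, hout, hfnd⟩ hf hp
    rw [Expr.eval_var, h18] at hp
    exact ⟨j, s, hj, hjs, hpos.imp_right fun h => ⟨h.1, by omega⟩, hout, hfnd⟩

/-- The number of steps that it takes to run through the buckets `c - d - hash x`, for `d < 4` and
all `x` in the sequence `X` of length `n`. -/
def load (a L H c : ℤ) (n : ℕ) (X : ℕ → ℤ) (Y : Finset ℤ) : ℕ :=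
  ∑ j ∈ Finset.range (4 * n),
    ((Y.filter (hash a L H · = (c - j % 4 - hash a L H (X (j / 4))) % H)).card + 1)

/-- `R` holds of the sums visited. That they are sums of entries is unconditional; that no relevant
pair is missed needs the bound on the load. -/
theorem wp_fill_scan {N n p b : ℕ} {e : Expr} {σ : State} {a L H c : ℤ} {X Y : ℕ → ℤ}
    (h0 : σ.var 0 = n) (h8 : σ.var 8 = L) (h9 : σ.var 9 = H)
    (h10 : σ.var 10 = L * H) (h11 : σ.var 11 = a)
    (he : ∀ σ' : State, σ'.var 12 = σ.var 12 → e.eval σ' = c) (hL : 0 < L) (hH : 0 < H)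
    (hX : ∀ i < n, σ.arr 0 (2 * p * n + i) = X i)
    (hY : ∀ i < n, σ.arr 0 ((2 * p + 1) * n + i) = Y i)
    (h1 : σ.arr (4 * p + 1) = 0) (h2 : σ.arr (4 * p + 2) = 0) (h5 : σ.arr (4 * p + 8) = 0)
    (hXb : ∀ i < n, |X i| ≤ b) (hYb : ∀ i < n, |Y i| ≤ b) (hbN : 2 * b ≤ N)
    (hnN : 6000 * n + 1 ≤ N) (hHN : H ≤ N) :
    Wp N (fillBuckets p ;; scanBuckets p e) (8 * n + 2 + (6000 * n * 13 + 4))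
      (fun σ' => ∃ R : ℤ → Prop, (∀ v, R v → ∃ i < n, ∃ i' < n, v = X i + Y i') ∧
        (load a L H c n X ((Finset.range n).image Y) ≤ 6000 * n → ∀ i < n, ∀ i' < n, ∀ d < 4,
          hash a L H (Y i') = (c - (d : ℕ) - hash a L H (X i)) % H → R (X i + Y i')) ∧
        (∀ v, 0 < σ'.arr (4 * p + 8) v ↔ R v) ∧
        (0 < σ'.var 19 ↔ 0 < σ.var 19 ∨ ∃ v, R v ∧ 0 < σ.arr (4 * p + 4) (-v))) σ := by
  have hbN' : (2 : ℤ) * b ≤ N := by exact_mod_cast hbN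
  refine Wp.seq (wp_fillBuckets h0 h8 h9 h10 h11 hL hH hY h1 h2
    (fun i hi => (hYb i hi).trans (by omega)) (by omega) hHN) ?_ le_rfl
  intro σ₁ hf hb
  rw [← hf.var 0 (by simp [Cmd.vars, fillBuckets])] at h0
  rw [← hf.var 8 (by simp [Cmd.vars, fillBuckets])] at h8
  rw [← hf.var 9 (by simp [Cmd.vars, fillBuckets])] at h9
  rw [← hf.var 10 (by simp [Cmd.vars, fillBuckets])] at h10
  rw [← hf.var 11 (by simp [Cmd.vars, fillBuckets])] at h11
  rw [← hf.var 12 (by simp [Cmd.vars, fillBuckets])] at he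
  rw [← hf.var 19 (by simp [Cmd.vars, fillBuckets]),
    ← hf.arr (4 * p + 4) (by simp [Cmd.arrs, fillBuckets])]
  rw [← hf.arr _ (by simp [Cmd.arrs, fillBuckets])] at h5 hX
  set Ys := (Finset.range n).image Y with hYs
  have hcard : Ys.card ≤ n := Finset.card_image_le.trans (by simp)
  set key : ℕ → ℤ := fun j => (c - j % 4 - hash a L H (X (j / 4))) % H with hkey
  set cnt : ℕ → ℕ := fun j => (Ys.filter (hash a L H · = key j)).card with hcnt
  set val : ℕ → ℕ → ℤ := fun j s => X (j / 4) + σ₁.arr (4 * p + 3) (s * H + key j) with hval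
  have hk0 : ∀ j, 0 ≤ key j := fun j => Int.emod_nonneg _ hH.ne'
  have hkH : ∀ j, key j < H := fun j => Int.emod_lt_of_pos _ hH
  refine Wp.mono (wp_scanBuckets h0 h8 h9 h10 h11 rfl he hH hX rfl rfl rfl h5 hb
    (fun i hi => (hXb i hi).trans (by omega)) ?_ hnN hHN (by omega) (key := key) (fun j => rfl)
    (cnt := cnt) (fun j => rfl) (val := val) (fun j s => rfl)) le_rfl ?_
  · intro i hi y hy
    obtain ⟨i', hi', rfl⟩ := Finset.mem_image.1 hy
    have := hXb i hi
    have := hYb i' (Finset.mem_range.1 hi')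
    exact (abs_add_le _ _).trans (by linarith)
  rintro σ' - ⟨j, s, hj, hjs, hpos, hout, hfnd⟩
  have hcntC : ∀ j, σ₁.arr (4 * p + 2) (key j) = cnt j := fun j => hb.size _
  refine ⟨Visited cnt val j s, ?_, ?_, hout, hfnd⟩
  · rintro v ⟨j', s', hlt, hs', rfl⟩
    have hj' : j' < 4 * n := by omega
    have hmem := hb.mem (key j') s' (hk0 _) (hkH _) (by omega) (by rw [hcntC]; omega)
    obtain ⟨i', hi', hy⟩ := Finset.mem_image.1 hmem
    exact ⟨j' / 4, by omega, i', Finset.mem_range.1 hi', by rw [hval, hy]⟩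
  · intro hload i hi i' hi' d hd hh
    -- Stopping inside a row would leave undone at least the step that closes its bucket, so the
    -- load would exceed the budget.
    have hj4 : j = 4 * n := by
      rcases hpos with h | ⟨hs, h⟩
      · exact h
      · by_contra hne
        have : ∑ j' ∈ Finset.range (j + 1), (cnt j' + 1) ≤ load a L H c n X Ys :=
          Finset.sum_le_sum_of_subset (by simp; omega)
        rw [Finset.sum_range_succ] at this
        omega
    -- The row `4 * i + d` is the one that belongs to the element `i` and the shift `d`.
    have hk : key (4 * i + d) = hash a L H (Y i') := by
      rw [hh, hkey]
      simp only [show (4 * i + d) / 4 = i by omega]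
      congr 3
      push_cast
      omega
    obtain ⟨s', h0', h1', h2'⟩ := hb.exists_index (Y i')
      (Finset.mem_image_of_mem _ (Finset.mem_range.2 hi'))
    rw [← hk, hcntC] at h1'
    rw [← hk] at h2'
    refine ⟨4 * i + d, s'.toNat, by omega, by omega, ?_⟩
    rw [hval]
    simp only [show (4 * i + d) / 4 = i by omega, Int.toNat_of_nonneg h0', h2']


/-! ### The verifier -/

theorem hash_decomp {L H : ℤ} (hL : 0 < L) (a x : ℤ) :
    ∃ q r, a * x = L * H * q + L * hash a L H x + r ∧ 0 ≤ r ∧ r < L :=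
  ⟨a * x / (L * H), a * x % (L * H) % L, by
    rw [hash, add_assoc, Int.mul_ediv_add_emod, Int.mul_ediv_add_emod],
    Int.emod_nonneg _ hL.ne', Int.emod_lt_of_pos _ hL⟩

/-- Adding the four decompositions `a * x = L * H * q + L * hash x + r` shows that the sum of the
remainders is a multiple `L * d`. It lies in `[0, 4 * L)`, hence `d < 4`. -/
theorem exists_dvd_hash_add {L : ℤ} (hL : 0 < L) (a H : ℤ) {x₁ x₂ x₃ x₄ : ℤ}
    (h : x₁ + x₂ + x₃ + x₄ = 0) : ∃ d : ℕ, d < 4 ∧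
      H ∣ hash a L H x₁ + hash a L H x₂ + hash a L H x₃ + hash a L H x₄ + d := by
  obtain ⟨q₁, r₁, h₁, l₁, u₁⟩ := hash_decomp (H := H) hL a x₁
  obtain ⟨q₂, r₂, h₂, l₂, u₂⟩ := hash_decomp (H := H) hL a x₂
  obtain ⟨q₃, r₃, h₃, l₃, u₃⟩ := hash_decomp (H := H) hL a x₃
  obtain ⟨q₄, r₄, h₄, l₄, u₄⟩ := hash_decomp (H := H) hL a x₄
  obtain ⟨d, hd⟩ : ∃ d, d = -(H * (q₁ + q₂ + q₃ + q₄) +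
    (hash a L H x₁ + hash a L H x₂ + hash a L H x₃ + hash a L H x₄)) := ⟨_, rfl⟩
  have key : L * d = r₁ + r₂ + r₃ + r₄ := by
    rw [hd]; linear_combination h₁ + h₂ + h₃ + h₄ - a * h
  have hd0 : 0 ≤ d := by
    by_contra hneg
    have : L * d < 0 := mul_neg_of_pos_of_neg hL (by omega)
    omega
  have hd4 : d < 4 := by
    by_contra hge
    have : L * 4 ≤ L * d := mul_le_mul_of_nonneg_left (by omega) hL.le
    omega
  refine ⟨d.toNat, by omega, -(q₁ + q₂ + q₃ + q₄), ?_⟩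
  rw [Int.toNat_of_nonneg hd0, hd]
  ring

/-- The program of the verifier: it sets the variable `19` to `1` if it finds a solution. -/
def fourSum (C e : ℕ) : Cmd :=
  readNat ;; .assign 0 (.var 4) ;; computeBound C e ;; readCoins ;; readProof ;; readInts ;;
    (fillBuckets 0 ;; scanBuckets 0 (.var 12)) ;;
    (fillBuckets 1 ;; scanBuckets 1 (.const 0 - .var 12))

theorem fourSum_valid (C e : ℕ) : (fourSum C e).Valid := by
  refine ⟨?_, ?_, ?_, ?_, ?_, ?_, ⟨?_, ?_⟩, ?_, ?_⟩ <;>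
    simp [Cmd.Valid, Expr.Valid, Expr.depth, readNat, computeBound, readCoins, readProof, readInts,
      readInt, fillBuckets, scanBuckets, hashExpr]

namespace KSumInstance

variable {k C e : ℕ} (I : KSumInstance k C e)

/-- The entry `i` of the sequence `j`, or `0` if there is no such entry. -/
def entry (j : Fin k) (i : ℕ) : ℤ := if h : i < I.n then I.A j ⟨i, h⟩ else 0

theorem abs_entry_le (j : Fin k) (i : ℕ) : |I.entry j i| ≤ (C * I.n ^ e : ℕ) := by
  unfold entry
  split
  · exact_mod_cast I.bound j _
  · rw [abs_zero]; positivity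

/-- The entries of all the sequences. -/
def entries : List ℤ := (List.finRange k).flatMap fun j => (List.finRange I.n).map (I.A j)

theorem encode_eq : I.encode = encodeNat I.n ++ I.entries.flatMap encodeInt := by
  simp [encode, entries, List.flatMap_assoc, List.flatMap_map]

theorem length_entries : I.entries.length = k * I.n := by
  simp [entries, List.length_flatMap]

theorem abs_le_of_mem_entries {z : ℤ} (h : z ∈ I.entries) : z.natAbs ≤ C * I.n ^ e := by
  simp only [entries, List.mem_flatMap, List.mem_map] at h
  obtain ⟨j, -, i, -, rfl⟩ := h
  have := I.bound j i
  zify; exact this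

end KSumInstance

theorem KSumInstance.getElem_entries {C e : ℕ} (I : KSumInstance 4 C e) (j : Fin 4) {i : ℕ}
    (hi : i < I.n) (h : j * I.n + i < I.entries.length) :
    I.entries[j * I.n + i] = I.entry j i := by
  have hfr : List.finRange 4 = [0, 1, 2, 3] := by decide
  rw [← Option.some_inj, ← List.getElem?_eq_getElem]
  simp only [entries, hfr, List.flatMap_cons, List.flatMap_nil, List.append_nil, entry, hi,
    dif_pos]
  fin_cases j
  · simp [List.getElem?_append, hi]
  · simp [List.getElem?_append, hi]
  · simp only [List.getElem?_append, List.getElem?_map, List.length_map, List.length_finRange]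
    rw [if_neg (by omega), if_neg (by omega), if_pos (by omega)]
    simp [show 2 * I.n + i - I.n - I.n = i by omega, hi]
  · simp only [List.getElem?_append, List.getElem?_map, List.length_map, List.length_finRange]
    rw [if_neg (by omega), if_neg (by omega), if_neg (by omega)]
    simp [show 3 * I.n + i - I.n - I.n - I.n = i by omega, hi]

/-- A bound on the numbers that the verifier handles. -/
def valueBound (C e n : ℕ) : ℕ :=
  6000 * (n + 1) + (8 * (C * n ^ e) + 1) * (n + 1) + C * (n + 1) ^ e + e

/-- A bound on the number of steps. -/
def stepBound (C e n : ℕ) : ℕ :=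
  5 * n.size + 4 * (4 * (C * n ^ e)).size + 7 * Nat.log 2 n + 3 * e +
    4 * n * (5 * (C * n ^ e).size + 10) + 156016 * n + 29

/-- The first conclusion gives soundness, for arbitrary tapes. The second is the deterministic half
of completeness: randomness will enter only through the two bounds on the load. -/
theorem wp_fourSum {C e : ℕ} (I : KSumInstance 4 C e) (ρ π : List Bool) {a L H r : ℤ}
    (hL : L = 2 ^ (4 * (C * I.n ^ e)).size) (hH : H = 2 ^ Nat.log 2 I.n)
    (ha : a = bitsValue ρ ((4 * (C * I.n ^ e)).size + Nat.log 2 I.n))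
    (hr : r = bitsValue π (Nat.log 2 I.n)) :
    Wp (valueBound C e I.n) (fourSum C e) (stepBound C e I.n) (fun σ =>
      (0 < σ.var 19 → (kSum 4 C e).Yes I) ∧
      ∀ i₁ < I.n, ∀ i₂ < I.n, ∀ i₃ < I.n, ∀ i₄ < I.n,
        I.entry 0 i₁ + I.entry 1 i₂ + I.entry 2 i₃ + I.entry 3 i₄ = 0 →
        r = (hash a L H (I.entry 0 i₁) + hash a L H (I.entry 1 i₂)) % H →
        load a L H r I.n (I.entry 0) ((Finset.range I.n).image (I.entry 1)) ≤ 6000 * I.n →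
        load a L H (-r) I.n (I.entry 2) ((Finset.range I.n).image (I.entry 3)) ≤ 6000 * I.n →
        0 < σ.var 19) (initialState I.encode ρ π) := by
  obtain ⟨n, hn⟩ : ∃ n, n = I.n := ⟨_, rfl⟩
  obtain ⟨b, hb⟩ : ∃ b, b = C * I.n ^ e := ⟨_, rfl⟩
  obtain ⟨N, hN⟩ : ∃ N, N = valueBound C e I.n := ⟨_, rfl⟩
  have hb' : b = C * n ^ e := by rw [hb, hn]
  have hN' : N = 6000 * (n + 1) + (8 * b + 1) * (n + 1) + C * (n + 1) ^ e + e := by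
    rw [hN, valueBound, ← hb, ← hn]
  -- Since `L ≤ 8 * b + 1` and `H ≤ n + 1`, this bounds `L * H` and with it the multiplier.
  have hN1 : (8 * b + 1) * (n + 1) ≤ N := by omega
  have hN2 : 8 * b + 1 ≤ N := by nlinarith
  have hN3 : 6000 * (n + 1) ≤ N := by omega
  have hHn : 2 ^ Nat.log 2 n ≤ n + 1 := by
    rcases Nat.eq_zero_or_pos n with rfl | h
    · simp
    · exact (Nat.pow_log_le_self 2 h.ne').trans (by omega)
  rw [← hN, ← hn]
  have hst : stepBound C e n = 5 * n.size + 4 * (4 * b).size + 7 * Nat.log 2 n + 3 * e +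
    4 * n * (5 * b.size + 10) + 156016 * n + 29 := by rw [stepBound, ← hb']
  rw [hst]
  rw [← hb] at hL ha
  rw [← hn] at hH ha hr
  have hL0 : 0 < L := by rw [hL]; positivity
  have hH0 : 0 < H := by rw [hH]; positivity
  have hHN : H ≤ N := by rw [hH]; exact_mod_cast (by omega : 2 ^ Nat.log 2 n ≤ N)
  refine Wp.seq (wp_readNat (m := n) (u := I.entries.flatMap encodeInt)
    (by rw [hn, ← I.encode_eq]; rfl) (by omega))
    (T' := 4 * (4 * b).size + 7 * Nat.log 2 n + 3 * e + 4 * n * (5 * b.size + 10) + 156016 * n + 25)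
    ?_ (by omega)
  rintro σ₁ f₁ ⟨h4, ht⟩
  refine Wp.seq (T := 1)
    (T' := 4 * (4 * b).size + 7 * Nat.log 2 n + 3 * e + 4 * n * (5 * b.size + 10) + 156016 * n + 24)
    (P := fun σ => σ.var 0 = n) (Cmd.wp_of_vc ?_) ?_ (by omega)
  · simp [Cmd.vc, h4]; omega
  rintro σ₂ f₂ h0
  refine Wp.seq (wp_computeBound (C := C) (e := e) h0 ?_ (by omega))
    (T' := 4 * (4 * b).size + 7 * Nat.log 2 n + 4 * n * (5 * b.size + 10) + 156016 * n + 21)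
    ?_ (by omega)
  · intro i hi
    -- The base `n + 1` covers the case `n = 0`, where `n ^ 0` is larger than `n ^ e` for positive
    -- `e`.
    have h1 : C * n ^ i ≤ C * (n + 1) ^ e := Nat.mul_le_mul_left _
      ((Nat.pow_le_pow_left (by omega) _).trans (Nat.pow_le_pow_right (by omega) hi))
    omega
  rintro σ₃ f₃ h7
  rw [← hb'] at h7
  rw [← f₃.var 0 (by simp [Cmd.vars, computeBound])] at h0
  refine Wp.seq (wp_readCoins h7 (u := ρ) ?_ hN2)
    (T' := 7 * Nat.log 2 n + 4 * n * (5 * b.size + 10) + 156016 * n + 18) ?_ (by omega)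
  · rw [f₃.tape _ (by simp [Cmd.tapes, computeBound]), f₂.tape _ (by simp [Cmd.tapes]),
      f₁.tape _ (by simp [Cmd.tapes, readNat])]
    rfl
  rintro σ₄ f₄ ⟨h8, h11, hco⟩
  rw [← f₄.var 0 (by simp [Cmd.vars, readCoins])] at h0
  refine Wp.seq (wp_readProof (u := ρ) (v := π) h0 h8 h11 hco ?_ ?_)
    (T' := 4 * n * (5 * b.size + 10) + 156016 * n + 14) ?_ (by omega)
  · rw [f₄.tape _ (by simp [Cmd.tapes, readCoins]), f₃.tape _ (by simp [Cmd.tapes, computeBound]),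
      f₂.tape _ (by simp [Cmd.tapes]), f₁.tape _ (by simp [Cmd.tapes, readNat])]
    rfl
  · have := two_pow_size_le (4 * b)
    exact (Nat.mul_le_mul_right (n + 1) (this.trans (by omega))).trans hN1
  rintro σ₅ f₅ ⟨h9, h10, h11, h12⟩
  rw [← f₅.var 0 (by simp [Cmd.vars, readProof])] at h0
  rw [← f₅.var 8 (by simp [Cmd.vars, readProof])] at h8
  rw [← hH] at h9
  rw [← hH, ← hL] at h10
  rw [← hL] at h8
  rw [← ha] at h11
  rw [← hr] at h12
  refine Wp.seq (wp_readInts (n := n) (s := b.size) (Z := I.entries) h0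
    (by rw [I.length_entries, hn]) ?_ ?_ ?_ (by omega)) (T' := 156016 * n + 12) ?_ (by omega)
  · rw [f₅.tape _ (by simp [Cmd.tapes, readProof]), f₄.tape _ (by simp [Cmd.tapes, readCoins]),
      f₃.tape _ (by simp [Cmd.tapes, computeBound]), f₂.tape _ (by simp [Cmd.tapes]), ht]
  · intro z hz
    have := I.abs_le_of_mem_entries hz
    omega
  · intro z hz
    exact Nat.size_le_size (hb ▸ I.abs_le_of_mem_entries hz)
  rintro σ₆ f₆ hin
  rw [← f₆.var 0 (by simp [Cmd.vars, readInts, readInt, readNat])] at h0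
  rw [← f₆.var 8 (by simp [Cmd.vars, readInts, readInt, readNat])] at h8
  rw [← f₆.var 9 (by simp [Cmd.vars, readInts, readInt, readNat])] at h9
  rw [← f₆.var 10 (by simp [Cmd.vars, readInts, readInt, readNat])] at h10
  rw [← f₆.var 11 (by simp [Cmd.vars, readInts, readInt, readNat])] at h11
  rw [← f₆.var 12 (by simp [Cmd.vars, readInts, readInt, readNat])] at h12
  have harr : ∀ t, t ≠ 0 → σ₆.arr t = 0 := by
    intro t ht0
    rw [f₆.arr _ (by simpa [Cmd.arrs, readInts, readInt, readNat] using ht0),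
      f₅.arr _ (by simp [Cmd.arrs, readProof]), f₄.arr _ (by simp [Cmd.arrs, readCoins]),
      f₃.arr _ (by simp [Cmd.arrs, computeBound]), f₂.arr _ (by simp [Cmd.arrs]),
      f₁.arr _ (by simp [Cmd.arrs, readNat])]
    rfl
  have h19 : σ₆.var 19 = 0 := by
    rw [f₆.var _ (by simp [Cmd.vars, readInts, readInt, readNat]),
      f₅.var _ (by simp [Cmd.vars, readProof]), f₄.var _ (by simp [Cmd.vars, readCoins]),
      f₃.var _ (by simp [Cmd.vars, computeBound]), f₂.var _ (by simp [Cmd.vars]),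
      f₁.var _ (by simp [Cmd.vars, readNat])]
    rfl
  have hentry : ∀ (j : Fin 4) (i : ℕ), i < n → σ₆.arr 0 ((j : ℕ) * n + i) = I.entry j i := by
    intro j i hi
    have hk : j * I.n + i < I.entries.length := by
      rw [I.length_entries, ← hn]
      have : (j : ℕ) * n ≤ 3 * n := Nat.mul_le_mul_right _ (by omega)
      omega
    have := hin _ hk
    rw [I.getElem_entries j (hn ▸ hi), ← hn] at this
    exact_mod_cast this
  have habs : ∀ (j : Fin 4) (i : ℕ), |I.entry j i| ≤ b := fun j i => by
    rw [hb]; exact I.abs_entry_le j i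
  refine Wp.seq (wp_fill_scan (p := 0) (b := b) (c := r) (X := I.entry 0) (Y := I.entry 1)
    h0 h8 h9 h10 h11 (fun σ' h' => h'.trans h12) hL0 hH0
    (fun i hi => by simpa using hentry 0 i hi) (fun i hi => by simpa using hentry 1 i hi)
    (harr _ (by simp)) (harr _ (by simp)) (harr _ (by simp)) (fun i _ => habs 0 i)
    (fun i _ => habs 1 i) (by omega) (by omega) hHN) (T' := 78008 * n + 6) ?_ (by omega)
  rintro σ₇ f₇ ⟨R, hR, hRl, hout, hfnd₇⟩
  -- The first scan looks up negated sums in array `4`, which nothing ever writes. The second looks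
  -- them up in array `8`, where the first has left its marks.
  have f19 : 0 < σ₇.var 19 ↔ False := by simpa [h19, harr 4 (by norm_num)] using hfnd₇
  rw [← f₇.var 0 (by simp [Cmd.vars, fillBuckets, scanBuckets])] at h0
  rw [← f₇.var 8 (by simp [Cmd.vars, fillBuckets, scanBuckets])] at h8
  rw [← f₇.var 9 (by simp [Cmd.vars, fillBuckets, scanBuckets])] at h9
  rw [← f₇.var 10 (by simp [Cmd.vars, fillBuckets, scanBuckets])] at h10
  rw [← f₇.var 11 (by simp [Cmd.vars, fillBuckets, scanBuckets])] at h11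
  rw [← f₇.var 12 (by simp [Cmd.vars, fillBuckets, scanBuckets])] at h12
  rw [← f₇.arr 0 (by simp [Cmd.arrs, fillBuckets, scanBuckets])] at hentry
  have harr' : ∀ t, t ∉ [0, 1, 2, 3, 8] → σ₇.arr t = 0 := by
    intro t ht0
    simp at ht0
    rw [f₇.arr _ (by simp [Cmd.arrs, fillBuckets, scanBuckets]; omega), harr _ (by omega)]
  refine Wp.mono (wp_fill_scan (p := 1) (b := b) (c := -r) (X := I.entry 2) (Y := I.entry 3)
    h0 h8 h9 h10 h11 (fun σ' h' => by simp [h', h12]) hL0 hH0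
    (fun i hi => by simpa using hentry 2 i hi) (fun i hi => by simpa using hentry 3 i hi)
    (harr' _ (by simp)) (harr' _ (by simp)) (harr' _ (by simp)) (fun i _ => habs 2 i)
    (fun i _ => habs 3 i) (by omega) (by omega) hHN) (by omega) ?_
  rintro σ₈ - ⟨R', hR', hRl', -, hfnd⟩
  rw [f19, false_or] at hfnd
  constructor
  · intro hpos
    obtain ⟨v, hv, hv'⟩ := hfnd.1 hpos
    obtain ⟨i₃, hi₃, i₄, hi₄, rfl⟩ := hR' v hv
    obtain ⟨i₁, hi₁, i₂, hi₂, h12'⟩ := hR _ ((hout _).1 hv')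
    rw [hn] at hi₁ hi₂ hi₃ hi₄
    refine ⟨![⟨i₁, hi₁⟩, ⟨i₂, hi₂⟩, ⟨i₃, hi₃⟩, ⟨i₄, hi₄⟩], ?_⟩
    simp only [KSumInstance.entry, hi₁, hi₂, hi₃, hi₄, dif_pos] at h12'
    simp [Fin.sum_univ_four]
    linarith
  · intro i₁ hi₁ i₂ hi₂ i₃ hi₃ i₄ hi₄ hsum hr' hl hl'
    have hhb := fun x => hash_bounds hL0 hH0 a x
    -- The proof is the exact sum of the first two hashes modulo `H`, so the first half is found at
    -- the shift `0`; only the second half needs the shift `d`.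
    have key1 := hRl hl i₁ hi₁ i₂ hi₂ 0 (by norm_num) (by
      have h1 := hhb (I.entry 1 i₂)
      rw [Nat.cast_zero, sub_zero, hr', Int.emod_sub_emod, add_sub_cancel_left,
        Int.emod_eq_of_lt h1.1 h1.2])
    obtain ⟨d, hd, hdvd⟩ := exists_dvd_hash_add hL0 a H hsum
    have key2 := hRl' hl' i₃ hi₃ i₄ hi₄ d hd (by
      have h1 := hhb (I.entry 3 i₄)
      have h2 : H ∣ hash a L H (I.entry 0 i₁) + hash a L H (I.entry 1 i₂) - r := by
        rw [hr']; exact Int.dvd_self_sub_emod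
      have h3 : hash a L H (I.entry 3 i₄) % H = (-r - d - hash a L H (I.entry 2 i₃)) % H := by
        refine Int.modEq_iff_dvd.2 ?_
        have h4 := dvd_sub h2 hdvd
        rwa [show ∀ x y z w : ℤ, x + y - r - (x + y + z + w + d) = -r - d - z - w by
          intros; ring] at h4
      rwa [Int.emod_eq_of_lt h1.1 h1.2] at h3)
    refine hfnd.2 ⟨_, key2, (hout _).2 ?_⟩
    convert key1 using 1
    linarith


/-! ### The number of collisions -/

open Classical in
-- As `a` runs up to `L * H`, the product `a * z` passes about `z` multiples of `L * H`, and it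
-- stays near each of them for about `10 * L / z` values of `a`.
theorem card_near_le_of_pos {L H : ℕ} {z : ℤ} (hH : 0 < H) (hz : 0 < z) (hzL : z ≤ L) :
    ((Finset.range (L * H)).filter fun a : ℕ =>
      ∃ m : ℤ, |(a : ℤ) * z - L * H * m| < 5 * L).card ≤ 120 * L := by
  have hL : (1 : ℤ) ≤ L := by omega
  have hH' : (1 : ℤ) ≤ H := by omega
  obtain ⟨q, hq⟩ : ∃ q : ℤ, q = 10 * L / z := ⟨_, rfl⟩
  have hq0 : 0 ≤ q := by rw [hq]; exact Int.ediv_nonneg (by omega) hz.le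
  have hqz : q * z ≤ 10 * L := by rw [hq]; exact Int.ediv_mul_le _ hz.ne'
  have hqz' : 10 * L < (q + 1) * z := by rw [hq]; exact Int.lt_ediv_add_one_mul_self _ hz
  -- From `0 ≤ a * z ≤ L * H * z` and `L ≤ L * H`, the multiple has an index `m` with `-5 < m < z +
  -- 5`, which leaves `z + 9` indices.
  have hsub : ((Finset.range (L * H)).filter fun a : ℕ =>
      ∃ m : ℤ, |(a : ℤ) * z - L * H * m| < 5 * L) ⊆ (Finset.Ioo (-5) (z + 5)).biUnion
        fun m => (Finset.range (L * H)).filter fun a : ℕ => |(a : ℤ) * z - L * H * m| < 5 * L := by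
    intro a ha
    obtain ⟨ha, m, hm⟩ := Finset.mem_filter.1 ha
    have haW : (a : ℤ) < L * H := by exact_mod_cast Finset.mem_range.1 ha
    refine Finset.mem_biUnion.2 ⟨m, Finset.mem_Ioo.2 ?_, Finset.mem_filter.2 ⟨ha, hm⟩⟩
    have hLH : (L : ℤ) ≤ L * H := by nlinarith
    have h0 : 0 ≤ (a : ℤ) * z := by positivity
    have h1 : (a : ℤ) * z ≤ L * H * z := by nlinarith
    rw [abs_lt] at hm
    constructor
    · by_contra hneg
      have : (L : ℤ) * H * m ≤ L * H * (-5) := mul_le_mul_of_nonneg_left (by omega) (by omega)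
      linarith
    · by_contra hneg
      have : (L : ℤ) * H * (z + 5) ≤ L * H * m := mul_le_mul_of_nonneg_left (by omega) (by omega)
      linarith
  -- For fixed `m`, the products `a * z` lie in an interval of length `10 * L`, so at most `q + 2`
  -- multipliers occur, where `q` is the quotient of `10 * L` by `z`.
  have hcard : ∀ m : ℤ, ((Finset.range (L * H)).filter fun a : ℕ =>
      |(a : ℤ) * z - L * H * m| < 5 * L).card ≤ (q + 2).toNat := by
    intro m
    obtain ⟨x, hx⟩ : ∃ x : ℤ, x = L * H * m - 5 * L := ⟨_, rfl⟩
    have hIcc : ((Finset.range (L * H)).filter fun a : ℕ =>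
        |(a : ℤ) * z - L * H * m| < 5 * L).card ≤ (Finset.Icc (x / z) ((x + 10 * L) / z)).card := by
      refine Finset.card_le_card_of_injOn (fun a : ℕ => (a : ℤ)) ?_
        (fun a _ b _ h => Int.ofNat_inj.1 h)
      intro a ha
      have ha' := (Finset.mem_filter.1 (Finset.mem_coe.1 ha)).2
      rw [abs_lt] at ha'
      exact Finset.mem_coe.2 (Finset.mem_Icc.2 ⟨Int.ediv_le_of_le_mul hz (by linarith),
        Int.le_ediv_of_mul_le hz (by linarith)⟩)
    refine hIcc.trans ?_
    rw [Int.card_Icc]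
    have h1 : x < (x / z + 1) * z := Int.lt_ediv_add_one_mul_self _ hz
    have h2 : (x + 10 * L) / z * z ≤ x + 10 * L := Int.ediv_mul_le _ hz.ne'
    have h3 : (x + 10 * L) / z < x / z + q + 2 := by
      by_contra hge
      have : (x / z + q + 2) * z ≤ (x + 10 * L) / z * z :=
        mul_le_mul_of_nonneg_right (by omega) hz.le
      linarith
    omega
  refine (Finset.card_le_card hsub).trans
    ((Finset.card_biUnion_le_card_mul _ _ _ fun m _ => hcard m).trans ?_)
  rw [Int.card_Ioo]
  -- Now `(z + 9) * (q + 2) = z * q + 2 * z + 9 * q + 18`, which is at most `(10 + 2 + 90 + 18) *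
  -- L`.
  have hq10 : q ≤ 10 * L := by nlinarith
  zify
  rw [Int.toNat_of_nonneg (by omega), Int.toNat_of_nonneg (by omega)]
  nlinarith

open Classical in
theorem card_near_le {L H : ℕ} {z : ℤ} (hH : 0 < H) (hz : z ≠ 0) (hzL : |z| ≤ L) :
    ((Finset.range (L * H)).filter fun a : ℕ =>
      ∃ m : ℤ, |(a : ℤ) * z - L * H * m| < 5 * L).card ≤ 120 * L := by
  rcases lt_or_gt_of_ne hz with h | h
  · have := card_near_le_of_pos (L := L) (z := -z) hH (by omega) (by rwa [abs_of_neg h] at hzL)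
    refine le_trans (Finset.card_le_card ?_) this
    refine Finset.monotone_filter_right _ ?_
    rintro a - ⟨m, hm⟩
    refine ⟨-m, ?_⟩
    rwa [← abs_neg, show -((a : ℤ) * -z - L * H * -m) = a * z - L * H * m by ring]
  · exact card_near_le_of_pos hH h (by rwa [abs_of_pos h] at hzL)

open Classical in
/-- The number of pairs whose sum is not `s` but has almost the same product with `a` modulo
`L * H`. -/
noncomputable def collisions (a L H s : ℤ) (n : ℕ) (X : ℕ → ℤ) (Y : Finset ℤ) : ℕ :=
  ∑ i ∈ Finset.range n,
    (Y.filter fun y => X i + y ≠ s ∧ ∃ m : ℤ, |a * (X i + y - s) - L * H * m| < 5 * L).card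

/-- Double counting: there are at most `n * n` pairs, and `card_near_le` bounds the multipliers for
which a given pair collides. -/
theorem sum_collisions_le {L H n : ℕ} {s : ℤ} {X : ℕ → ℤ} {Y : Finset ℤ} (hH : 0 < H)
    (hY : Y.card ≤ n) (hL : ∀ i < n, ∀ y ∈ Y, |X i + y - s| ≤ L) :
    ∑ a ∈ Finset.range (L * H), collisions a L H s n X Y ≤ n * n * (120 * L) := by
  classical
  simp only [collisions, Finset.card_filter]
  rw [Finset.sum_comm]
  have key : ∀ i ∈ Finset.range n, ∑ a ∈ Finset.range (L * H), ∑ y ∈ Y,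
      (if X i + y ≠ s ∧ ∃ m : ℤ, |(a : ℤ) * (X i + y - s) - L * H * m| < 5 * L then 1 else 0) ≤
        n * (120 * L) := by
    intro i hi
    rw [Finset.sum_comm]
    refine (Finset.sum_le_card_nsmul Y _ (120 * L) fun y hy => ?_).trans ?_
    · rw [← Finset.card_filter]
      by_cases hs : X i + y = s
      · simp [hs]
      · simp only [ne_eq, hs, not_false_eq_true, true_and]
        exact card_near_le hH (by omega) (hL i (Finset.mem_range.1 hi) y hy)
    · rw [smul_eq_mul]; exact Nat.mul_le_mul_right _ hY
  refine (Finset.sum_le_card_nsmul _ _ _ key).trans ?_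
  rw [Finset.card_range, smul_eq_mul, mul_assoc]

/-- For each element `x` and each of the four shifts, there is one step to close the bucket, at most
one entry `y = s - x`, and otherwise only collisions. This gives `4 * 2` steps per element plus four
times the collisions. -/
theorem load_le {a L H c s : ℤ} {X : ℕ → ℤ} {Y : Finset ℤ} (n : ℕ)
    (hnear : ∀ x y : ℤ, ∀ d : ℕ, d < 4 → hash a L H y = (c - d - hash a L H x) % H →
      ∃ m : ℤ, |a * (x + y - s) - L * H * m| < 5 * L) :
    load a L H c n X Y ≤ 8 * n + 4 * collisions a L H s n X Y := by
  classical
  induction n with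
  | zero => simp [load]
  | succ n ih =>
    have key : ∀ d : ℕ, d < 4 → (Y.filter (hash a L H · = (c - (4 * n + d : ℕ) % 4 -
        hash a L H (X ((4 * n + d) / 4))) % H)).card ≤ 1 + (Y.filter fun y => X n + y ≠ s ∧
          ∃ m : ℤ, |a * (X n + y - s) - L * H * m| < 5 * L).card := by
      intro d hd
      rw [show (4 * n + d) / 4 = n by omega, show (((4 * n + d : ℕ) : ℤ)) % 4 = d by omega]
      rw [← Finset.card_singleton (s - X n)]
      refine (Finset.card_le_card ?_).trans (Finset.card_union_le _ _)
      intro y hy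
      obtain ⟨hy, hh⟩ := Finset.mem_filter.1 hy
      by_cases hs : X n + y = s
      · exact Finset.mem_union_left _ (Finset.mem_singleton.2 (by omega))
      · exact Finset.mem_union_right _ (Finset.mem_filter.2 ⟨hy, hs, hnear _ _ d hd hh⟩)
    have h0 := key 0 (by norm_num)
    have h1 := key 1 (by norm_num)
    have h2 := key 2 (by norm_num)
    have h3 := key 3 (by norm_num)
    rw [add_zero] at h0
    unfold load at ih ⊢
    unfold collisions at ih ⊢
    rw [show 4 * (n + 1) = 4 * n + 1 + 1 + 1 + 1 by ring]
    simp only [Finset.sum_range_succ]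
    simp only [add_assoc] at *
    omega

/-- Modulo `L * H`, the product is `r + r' - r₁ - r₂ - L * d` with remainders in `[0, L)` and `d ≤
3`, which lies strictly between `-5 * L` and `2 * L`. -/
theorem exists_near_of_hash_eq {L : ℤ} (hL : 0 < L) {a H c x₁ x₂ : ℤ}
    (hc : H ∣ c - (hash a L H x₁ + hash a L H x₂)) (x y : ℤ) (d : ℕ) (hd : d < 4)
    (h : hash a L H y = (c - d - hash a L H x) % H) :
    ∃ m : ℤ, |a * (x + y - (x₁ + x₂)) - L * H * m| < 5 * L := by
  obtain ⟨q, r, e, l, u⟩ := hash_decomp (H := H) hL a x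
  obtain ⟨q', r', e', l', u'⟩ := hash_decomp (H := H) hL a y
  obtain ⟨q₁, r₁, e₁, l₁, u₁⟩ := hash_decomp (H := H) hL a x₁
  obtain ⟨q₂, r₂, e₂, l₂, u₂⟩ := hash_decomp (H := H) hL a x₂
  have hdvd : H ∣ c - d - hash a L H x - hash a L H y := by
    rw [h]; exact Int.dvd_self_sub_emod
  obtain ⟨t, ht⟩ := dvd_sub hc hdvd
  refine ⟨q + q' - q₁ - q₂ + t, ?_⟩
  have key : a * (x + y - (x₁ + x₂)) - L * H * (q + q' - q₁ - q₂ + t) =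
      r + r' - r₁ - r₂ - L * d := by
    linear_combination e + e' - e₁ - e₂ + L * ht
  have h1 : L * d ≤ L * 3 := mul_le_mul_of_nonneg_left (by omega) hL.le
  have h2 : 0 ≤ L * d := by positivity
  rw [key, abs_lt]
  constructor <;> linarith

/-- The version for the second half of a solution, whose target sum is the negative of that of the
first half; here all four remainders enter with a plus sign. -/
theorem exists_near_of_hash_eq_neg {L : ℤ} (hL : 0 < L) {a H c x₁ x₂ : ℤ}
    (hc : H ∣ c + (hash a L H x₁ + hash a L H x₂)) (x y : ℤ) (d : ℕ) (hd : d < 4)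
    (h : hash a L H y = (c - d - hash a L H x) % H) :
    ∃ m : ℤ, |a * (x + y - (-(x₁ + x₂))) - L * H * m| < 5 * L := by
  obtain ⟨q, r, e, l, u⟩ := hash_decomp (H := H) hL a x
  obtain ⟨q', r', e', l', u'⟩ := hash_decomp (H := H) hL a y
  obtain ⟨q₁, r₁, e₁, l₁, u₁⟩ := hash_decomp (H := H) hL a x₁
  obtain ⟨q₂, r₂, e₂, l₂, u₂⟩ := hash_decomp (H := H) hL a x₂
  have hdvd : H ∣ c - d - hash a L H x - hash a L H y := by
    rw [h]; exact Int.dvd_self_sub_emod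
  obtain ⟨t, ht⟩ := dvd_sub hc hdvd
  refine ⟨q + q' + q₁ + q₂ + t, ?_⟩
  have key : a * (x + y - (-(x₁ + x₂))) - L * H * (q + q' + q₁ + q₂ + t) =
      r + r' + r₁ + r₂ - L * d := by
    linear_combination e + e' + e₁ + e₂ + L * ht
  have h1 : L * d ≤ L * 3 := mul_le_mul_of_nonneg_left (by omega) hL.le
  have h2 : 0 ≤ L * d := by positivity
  rw [key, abs_lt]
  constructor <;> linarith

open Classical in
/-- For at least two thirds of the multipliers, there are few collisions. -/
theorem card_many_collisions_le {L H n : ℕ} {s s' : ℤ} {X X' : ℕ → ℤ} {Y Y' : Finset ℤ}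
    (hn : 0 < n) (hnH : n ≤ 2 * H) (hY : Y.card ≤ n) (hY' : Y'.card ≤ n)
    (hL : ∀ i < n, ∀ y ∈ Y, |X i + y - s| ≤ L) (hL' : ∀ i < n, ∀ y ∈ Y', |X' i + y - s'| ≤ L) :
    3 * ((Finset.range (L * H)).filter fun a : ℕ => 1440 * n <
      collisions a L H s n X Y + collisions a L H s' n X' Y').card ≤ L * H := by
  have hH : 0 < H := by omega
  have h1 := sum_collisions_le hH hY hL
  have h2 := sum_collisions_le hH hY' hL'
  set S := (Finset.range (L * H)).filter fun a : ℕ => 1440 * n <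
      collisions a L H s n X Y + collisions a L H s' n X' Y' with hS
  -- Markov's inequality: the total over all multipliers is at most `240 * L * n * n ≤ 480 * n * (L
  -- * H)`, a third of the threshold `1440 * n` times their number.
  have h3 : S.card • (1440 * n) ≤ ∑ a ∈ S, (collisions a L H s n X Y +
      collisions a L H s' n X' Y') :=
    Finset.card_nsmul_le_sum _ _ _ fun a ha => (Finset.mem_filter.1 ha).2.le
  have h4 : ∑ a ∈ S, (collisions a L H s n X Y + collisions a L H s' n X' Y') ≤
      ∑ a ∈ Finset.range (L * H), (collisions a L H s n X Y + collisions a L H s' n X' Y') :=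
    Finset.sum_le_sum_of_subset (Finset.filter_subset _ _)
  rw [smul_eq_mul] at h3
  replace h3 := h3.trans h4
  rw [Finset.sum_add_distrib] at h3
  have h5 : S.card * (1440 * n) ≤ 240 * L * (n * n) := by nlinarith
  have h6 : n * n * L ≤ n * (2 * H) * L := by gcongr
  have h7 : (3 * S.card) * (480 * n) ≤ (L * H) * (480 * n) := by nlinarith
  exact Nat.le_of_mul_le_mul_right h7 (by omega)

/-! ### Coins and proofs as numbers -/

theorem bitsValue_nonneg {l : List Bool} {k : ℕ} (h : k ≤ l.length) : 0 ≤ bitsValue l k := by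
  induction k with
  | zero => simp [bitsValue]
  | succ k ih =>
    have := ih (by omega)
    rw [bitsValue, List.drop_eq_getElem_cons (by omega), readValue_cons]
    positivity

theorem getElem_eq_of_bitsValue_eq {l l' : List Bool} {k : ℕ} (h : k ≤ l.length)
    (h' : k ≤ l'.length) (he : bitsValue l k = bitsValue l' k) (i : ℕ) (hi : i < k) :
    l[i]'(by omega) = l'[i]'(by omega) := by
  induction k with
  | zero => omega
  | succ k ih =>
    rw [bitsValue, List.drop_eq_getElem_cons (by omega), readValue_cons, bitsValue,
      List.drop_eq_getElem_cons (by omega), readValue_cons] at he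
    have h1 : l[k] = l'[k] := by
      cases h1 : l[k] <;> cases h2 : l'[k] <;> simp [h1, h2] at he ⊢ <;> omega
    rw [h1] at he
    rcases Nat.lt_succ_iff_lt_or_eq.1 hi with hik | rfl
    · exact ih (by omega) (by omega) (by omega) hik
    · exact h1

theorem bitsValue_append {l u : List Bool} {k : ℕ} (h : k ≤ l.length) :
    bitsValue (l ++ u) k = bitsValue l k := by
  induction k with
  | zero => rfl
  | succ k ih =>
    rw [bitsValue, bitsValue, ih (by omega), List.drop_append_of_le_length (by omega),
      List.drop_eq_getElem_cons (by omega), List.cons_append, readValue_cons, readValue_cons]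

theorem exists_bitsValue_eq (k : ℕ) {r : ℤ} (h0 : 0 ≤ r) (hr : r < 2 ^ k) :
    ∃ l : List Bool, l.length = k ∧ bitsValue l k = r := by
  induction k generalizing r with
  | zero => exact ⟨[], rfl, by simp [bitsValue]; omega⟩
  | succ k ih =>
    rw [pow_succ] at hr
    obtain ⟨l, hl, hv⟩ := ih (r := r / 2) (by omega) (by omega)
    refine ⟨l ++ [decide (r % 2 = 1)], by simp [hl], ?_⟩
    rw [bitsValue, bitsValue_append hl.ge, hv, List.drop_append_of_le_length hl.ge,
      List.drop_of_length_le hl.le, List.nil_append, readValue_cons]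
    rcases Int.emod_two_eq_zero_or_one r with h | h <;> simp [h] <;> omega

/-- A coin string is determined by the number that its first `k` bits represent together with its
other `T - k` bits. -/
theorem ncard_bitsValue_le {T k : ℕ} (hk : k ≤ T) (S : Finset ℕ) :
    {ρ : Fin T → Bool | ∃ v ∈ S, bitsValue (List.ofFn ρ) k = v}.ncard ≤ S.card * 2 ^ (T - k) := by
  classical
  have h1 : (S ×ˢ (Finset.univ : Finset (Fin (T - k) → Bool))).card = S.card * 2 ^ (T - k) := by
    simp [Finset.card_product]
  rw [← h1, ← Set.ncard_coe_finset]
  refine Set.ncard_le_ncard_of_injOn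
    (fun ρ => ((bitsValue (List.ofFn ρ) k).toNat, fun i => ρ ⟨k + i, by omega⟩)) ?_ ?_
    (Finset.finite_toSet _)
  · rintro ρ ⟨v, hv, he⟩
    simp [he, hv]
  · rintro ρ - ρ' - he
    simp only [Prod.mk.injEq] at he
    have h2 : bitsValue (List.ofFn ρ) k = bitsValue (List.ofFn ρ') k := by
      have := bitsValue_nonneg (l := List.ofFn ρ) (k := k) (by simpa using hk)
      have := bitsValue_nonneg (l := List.ofFn ρ') (k := k) (by simpa using hk)
      omega
    funext i
    rcases Nat.lt_or_ge i k with hi | hi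
    · simpa using getElem_eq_of_bitsValue_eq (by simpa using hk) (by simpa using hk) h2 i hi
    · have := congrFun he.2 ⟨i - k, by omega⟩
      simpa [Nat.add_sub_cancel' hi] using this

/-- An event that fails only if the number given by the first `k` coins is in `S` has probability at
least `2 / 3`, if `S` contains at most a third of all numbers. -/
theorem two_thirds_le_coinProb {T k : ℕ} (hk : k ≤ T) {S : Finset ℕ} (hS : 3 * S.card ≤ 2 ^ k)
    {E : Set (Fin T → Bool)}
    (hE : ∀ ρ, (∀ v ∈ S, bitsValue (List.ofFn ρ) k ≠ v) → ρ ∈ E) : 2 / 3 ≤ coinProb E := by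
  have h1 : 3 * Eᶜ.ncard ≤ 2 ^ T := by
    have h2 : Eᶜ.ncard ≤ S.card * 2 ^ (T - k) := by
      refine (Set.ncard_le_ncard ?_ (Set.toFinite _)).trans (ncard_bitsValue_le hk S)
      intro ρ hρ
      by_contra hne
      exact hρ (hE ρ fun v hv he => hne ⟨v, hv, he⟩)
    calc 3 * Eᶜ.ncard ≤ 3 * (S.card * 2 ^ (T - k)) := by omega
      _ = (3 * S.card) * 2 ^ (T - k) := by ring
      _ ≤ 2 ^ k * 2 ^ (T - k) := Nat.mul_le_mul_right _ hS
      _ = 2 ^ T := by rw [← pow_add, Nat.add_sub_cancel' hk]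
  have h3 : E.ncard + Eᶜ.ncard = 2 ^ T := by
    rw [Set.ncard_add_ncard_compl]; simp [Nat.card_eq_fintype_card]
  rw [coinProb, div_le_div_iff₀ (by norm_num) (by positivity)]
  have h4 : (2 : ℝ) ^ T = E.ncard + Eᶜ.ncard := by exact_mod_cast h3.symm
  have h5 : 3 * (Eᶜ.ncard : ℝ) ≤ 2 ^ T := by exact_mod_cast h1
  linarith


/-! ### The running time -/

/-- Take logarithms in `2 ^ (f n).size ≤ 2 * (K + 1) * n ^ k`. For `n ≥ 2` the constant terms are
absorbed, since `Real.log n / Real.log 2 ≥ 1`. -/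
theorem size_le_log {f : ℕ → ℕ} {K k : ℕ} (hf : ∀ n, 2 ≤ n → f n ≤ K * n ^ k) :
    ∃ A : ℝ, 0 ≤ A ∧ ∀ n, 2 ≤ n → ((f n).size : ℝ) ≤ A * Real.log n := by
  have h2 : 0 < Real.log 2 := Real.log_pos (by norm_num)
  have hK : 0 ≤ Real.log (K + 1) := Real.log_nonneg (by linarith [Nat.cast_nonneg (α := ℝ) K])
  refine ⟨1 / Real.log 2 + Real.log (K + 1) / Real.log 2 ^ 2 + k / Real.log 2, by positivity,
    fun n hn => ?_⟩
  have hn' : (2 : ℝ) ≤ n := by exact_mod_cast hn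
  have hlog : Real.log 2 ≤ Real.log n := Real.log_le_log (by norm_num) hn'
  have key : ((f n).size : ℝ) * Real.log 2 ≤ Real.log 2 + Real.log (K + 1) + k * Real.log n := by
    have h3 : 2 ^ (f n).size ≤ 2 * ((K + 1) * n ^ k) := by
      have := two_pow_size_le (f n)
      have := hf n hn
      have : 1 ≤ n ^ k := Nat.one_le_pow _ _ (by omega)
      nlinarith
    have h4 : ((2 : ℝ) ^ (f n).size) ≤ 2 * ((K + 1) * n ^ k) := by exact_mod_cast h3
    have h5 := Real.log_le_log (by positivity) h4
    rw [Real.log_pow, Real.log_mul (by norm_num) (by positivity),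
      Real.log_mul (by positivity) (by positivity), Real.log_pow] at h5
    linarith
  have h6 : 1 ≤ Real.log n / Real.log 2 := (one_le_div h2).2 hlog
  calc ((f n).size : ℝ) = (f n).size * Real.log 2 / Real.log 2 := by field_simp
    _ ≤ (Real.log 2 + Real.log (K + 1) + k * Real.log n) / Real.log 2 := by gcongr
    _ = 1 + Real.log (K + 1) / Real.log 2 * 1 + k * Real.log n / Real.log 2 := by field_simp
    _ ≤ Real.log n / Real.log 2 + Real.log (K + 1) / Real.log 2 * (Real.log n / Real.log 2) +
        k * Real.log n / Real.log 2 := by gcongr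
    _ = _ := by field_simp

theorem valueBound_le (C e n : ℕ) (hn : 2 ≤ n) :
    valueBound C e n ≤ (6001 + 9 * C + e) * n ^ (2 * e + 2) := by
  have h1 : n + 1 ≤ n ^ 2 := by nlinarith
  have h2 : (n + 1) ^ e ≤ n ^ (2 * e) := by
    rw [pow_mul]; exact Nat.pow_le_pow_left h1 e
  have h3 : n ^ e ≤ n ^ (2 * e) := Nat.pow_le_pow_right (by omega) (by omega)
  have h4 : 1 ≤ n ^ (2 * e) := Nat.one_le_pow _ _ (by omega)
  have h5 : 1 ≤ n ^ 2 := Nat.one_le_pow _ _ (by omega)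
  rw [pow_add, valueBound]
  have a1 : n + 1 ≤ n ^ (2 * e) * n ^ 2 := by nlinarith
  have a2 : n ^ e * (n + 1) ≤ n ^ (2 * e) * n ^ 2 := Nat.mul_le_mul h3 h1
  have a3 : (n + 1) ^ e ≤ n ^ (2 * e) * n ^ 2 := by nlinarith
  have a4 : 1 ≤ n ^ (2 * e) * n ^ 2 := by nlinarith
  have b2 := Nat.mul_le_mul_left (8 * C) a2
  have b3 := Nat.mul_le_mul_left C a3
  have b4 := Nat.mul_le_mul_left e a4
  nlinarith

theorem isSoftO_time (w C e : ℕ) : IsSoftO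
    (fun n => w * bitLength (valueBound C e n) * (stepBound C e n + 1)) (fun n => (n : ℝ)) := by
  obtain ⟨A₁, hA₁, h₁⟩ := size_le_log (f := valueBound C e) (valueBound_le C e)
  obtain ⟨A₂, hA₂, h₂⟩ := size_le_log (f := fun n => n) (K := 1) (k := 1) (by simp)
  obtain ⟨A₃, hA₃, h₃⟩ := size_le_log (f := fun n => C * n ^ e) (fun n _ => le_rfl)
  obtain ⟨A₄, hA₄, h₄⟩ := size_le_log (f := fun n => 4 * (C * n ^ e)) (K := 4 * C) (k := e)
    (fun n _ => by rw [mul_assoc])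
  have hl2 : 0 < Real.log 2 := Real.log_pos (by norm_num)
  obtain ⟨D, hD, hD'⟩ : ∃ D : ℝ, 0 ≤ D ∧ 1 = D * Real.log 2 :=
    ⟨1 / Real.log 2, by positivity, by field_simp⟩
  -- One logarithm is the bit length of the numbers handled, the other comes from reading the
  -- entries bit by bit.
  refine ⟨2, Asymptotics.IsBigO.of_bound (w * (A₁ + D) * (5 * A₂ + 4 * A₄ + 7 * A₂ + 3 * e * D +
    4 * (5 * A₃ + 10 * D) + 156016 * D + 30 * D)) ?_⟩
  filter_upwards [Filter.eventually_ge_atTop 2] with n hn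
  have hn' : (2 : ℝ) ≤ n := by exact_mod_cast hn
  have hlog : Real.log 2 ≤ Real.log n := Real.log_le_log (by norm_num) hn'
  have hlog0 : 0 < Real.log n := hl2.trans_le hlog
  have h1D : 1 ≤ D * Real.log n := hD'.le.trans (mul_le_mul_of_nonneg_left hlog hD)
  have k1 := h₁ n hn
  have k2 := h₂ n hn
  have k3 := h₃ n hn
  have k4 := h₄ n hn
  have k5 : (Nat.log 2 n : ℝ) ≤ A₂ * Real.log n := by
    refine le_trans ?_ k2
    have : Nat.log 2 n < n.size := Nat.lt_size.2 (Nat.pow_log_le_self 2 (by omega))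
    exact_mod_cast this.le
  have hbit : ((bitLength (valueBound C e n) : ℕ) : ℝ) ≤ (A₁ + D) * Real.log n := by
    simp only [bitLength, Int.natAbs_natCast]
    push_cast
    linarith
  have hn1 : (1 : ℝ) ≤ n := by linarith
  have up : ∀ x : ℝ, 0 ≤ x → x ≤ x * n := fun x hx => by nlinarith
  have hstep : ((stepBound C e n : ℕ) : ℝ) + 1 ≤ (5 * A₂ + 4 * A₄ + 7 * A₂ + 3 * e * D +
      4 * (5 * A₃ + 10 * D) + 156016 * D + 30 * D) * (n * Real.log n) := by
    have e0 : (0 : ℝ) ≤ e := Nat.cast_nonneg e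
    have u2 := up (A₂ * Real.log n) (by positivity)
    have u4 := up (A₄ * Real.log n) (by positivity)
    have uD := up (D * Real.log n) (by positivity)
    have ue := mul_le_mul_of_nonneg_left (h1D.trans uD) e0
    have v3 : (n : ℝ) * (5 * ((C * n ^ e).size : ℝ) + 10) ≤
        n * (5 * (A₃ * Real.log n) + 10 * (D * Real.log n)) := by gcongr; linarith
    have vD : (n : ℝ) * 1 ≤ n * (D * Real.log n) := by gcongr
    simp only [stepBound]
    push_cast at k1 k2 k3 k4 k5 v3 ⊢
    linarith
  rw [Real.norm_of_nonneg (by positivity), Real.norm_of_nonneg (by positivity)]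
  push_cast
  calc (w : ℝ) * (bitLength (valueBound C e n) : ℕ) * ((stepBound C e n : ℕ) + 1)
      ≤ w * ((A₁ + D) * Real.log n) * ((5 * A₂ + 4 * A₄ + 7 * A₂ + 3 * e * D +
      4 * (5 * A₃ + 10 * D) + 156016 * D + 30 * D) * (n * Real.log n)) := by gcongr
    _ = _ := by ring

theorem length_le_logb {n : ℕ} {l : List Bool} (hn : 0 < n) (hl : l.length = Nat.log 2 n) :
    (l.length : ℝ) ≤ Real.logb 2 n := by
  rw [hl, Real.le_logb_iff_rpow_le (by norm_num) (by exact_mod_cast hn), Real.rpow_natCast]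
  exact_mod_cast Nat.pow_log_le_self 2 hn.ne'

/-! ### The protocol -/

/-- On a yes-instance, at most a third of the multipliers is bad, and with any other multiplier, the
program finds a solution if the proof is the bucket of its first half. -/
theorem exists_bad_multipliers {C e : ℕ} (I : KSumInstance 4 C e) (h : (kSum 4 C e).Yes I) :
    ∃ S : Finset ℕ, 3 * S.card ≤ 2 ^ ((4 * (C * I.n ^ e)).size + Nat.log 2 I.n) ∧
      0 < I.n ∧ ∀ a : ℕ, a < 2 ^ ((4 * (C * I.n ^ e)).size + Nat.log 2 I.n) → a ∉ S →
        ∀ L H : ℤ, L = 2 ^ (4 * (C * I.n ^ e)).size → H = 2 ^ Nat.log 2 I.n →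
        ∃ i₁ < I.n, ∃ i₂ < I.n, ∃ i₃ < I.n, ∃ i₄ < I.n,
          I.entry 0 i₁ + I.entry 1 i₂ + I.entry 2 i₃ + I.entry 3 i₄ = 0 ∧
          ∀ r, r = (hash a L H (I.entry 0 i₁) + hash a L H (I.entry 1 i₂)) % H →
            load a L H r I.n (I.entry 0) ((Finset.range I.n).image (I.entry 1)) ≤ 6000 * I.n ∧
            load a L H (-r) I.n (I.entry 2) ((Finset.range I.n).image (I.entry 3)) ≤
              6000 * I.n := by
  classical
  obtain ⟨i, hi⟩ := h
  have hi : ∑ j, I.A j (i j) = 0 := hi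
  rw [Fin.sum_univ_four] at hi
  have hent : ∀ j, I.entry j (i j) = I.A j (i j) := fun j => by simp [KSumInstance.entry]
  simp only [← hent] at hi
  have hn : 0 < I.n := (Nat.zero_le _).trans_lt (i 0).2
  set b := C * I.n ^ e with hb
  set L₀ := 2 ^ (4 * b).size with hL₀
  set H₀ := 2 ^ Nat.log 2 I.n with hH₀
  -- The solution, and with it `s`, is fixed before the multiplier, so the collision count averages
  -- over multipliers for this one target only.
  set s := I.entry 0 (i 0) + I.entry 1 (i 1) with hs
  -- The differences `x + y - s` involve four entries, hence the factor `4` needed for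
  -- `card_many_collisions_le`.
  have hbL : 4 * b < L₀ := Nat.lt_size_self _
  have hnH : I.n ≤ 2 * H₀ := by
    have := Nat.lt_pow_succ_log_self (b := 2) (by norm_num) I.n
    rw [pow_succ] at this
    omega
  have habs : ∀ j i, -(b : ℤ) ≤ I.entry j i ∧ I.entry j i ≤ b := fun j i =>
    abs_le.1 (I.abs_entry_le j i)
  have hcard : ∀ j, ((Finset.range I.n).image (I.entry j)).card ≤ I.n := fun j =>
    Finset.card_image_le.trans (by simp)
  have hb0 := habs 0 (i 0)
  have hb1 := habs 1 (i 1)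
  have hbad := card_many_collisions_le (L := L₀) (H := H₀) (s := s) (s' := -s)
    (X := I.entry 0) (X' := I.entry 2) hn hnH (hcard 1) (hcard 3) (by
      intro j _ y hy
      obtain ⟨j', -, rfl⟩ := Finset.mem_image.1 hy
      have := habs 0 j
      have := habs 1 j'
      rw [abs_le]; omega) (by
      intro j _ y hy
      obtain ⟨j', -, rfl⟩ := Finset.mem_image.1 hy
      have := habs 2 j
      have := habs 3 j'
      rw [abs_le]; omega)
  rw [← pow_add] at hbad
  refine ⟨_, hbad, hn, ?_⟩
  intro a ha haS L H hL hH
  have hL' : L = (L₀ : ℤ) := by rw [hL, hL₀]; push_cast; rfl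
  have hH' : H = (H₀ : ℤ) := by rw [hH, hH₀]; push_cast; rfl
  have hL0 : 0 < L := by rw [hL]; positivity
  have hcol := fun h' => haS (Finset.mem_filter.2 ⟨Finset.mem_range.2 ha, h'⟩)
  rw [← hL', ← hH'] at hcol
  replace hcol := not_lt.1 hcol
  refine ⟨i 0, (i 0).2, i 1, (i 1).2, i 2, (i 2).2, i 3, (i 3).2, hi, ?_⟩
  intro r hr
  have hd : H ∣ r - (hash a L H (I.entry 0 (i 0)) + hash a L H (I.entry 1 (i 1))) := by
    rw [hr]; exact Int.dvd_emod_sub_self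
  have hd' : H ∣ -r + (hash a L H (I.entry 0 (i 0)) + hash a L H (I.entry 1 (i 1))) := by
    obtain ⟨t, ht⟩ := hd
    exact ⟨-t, by linear_combination -ht⟩
  have l1 := load_le (s := s) (Y := (Finset.range I.n).image (I.entry 1)) (X := I.entry 0) I.n
    (exists_near_of_hash_eq hL0 hd)
  have l2 := load_le (s := -s) (Y := (Finset.range I.n).image (I.entry 3)) (X := I.entry 2) I.n
    (exists_near_of_hash_eq_neg hL0 hd')
  -- Each load is at most `8 * n + 4 * 1440 * n = 5768 * n`.
  omega

end ArthurMerlin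

open ArthurMerlin in
theorem mainTheorem3 (C e : ℕ) :
    ∃ t : ℕ → ℕ, ArthurMerlin.IsSoftO t (fun n => (n : ℝ)) ∧
      ArthurMerlin.kSum 4 C e ∈ ArthurMerlin.AM (fun n => Real.logb 2 n) t := by
  obtain ⟨w, hw⟩ := (fourSum C e).verifier_halts (fourSum_valid C e) (v := 19) (by norm_num)
  -- The factor `w + 1` instead of `w` makes sure that `t n` exceeds the step bound even if `w = 0`,
  -- so that there are enough coins for the multiplier.
  obtain ⟨t, ht⟩ : ∃ t : ℕ → ℕ, t = fun n =>
    (w + 1) * bitLength (valueBound C e n) * (stepBound C e n + 1) := ⟨_, rfl⟩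
  refine ⟨t, ht ▸ isSoftO_time (w + 1) C e, (fourSum C e).verifier 19, fun I => ?_⟩
  change KSumInstance 4 C e at I
  change (∀ (ρ : Fin (t I.n) → Bool) (π : List Bool), (π.length : ℝ) ≤ Real.logb 2 I.n →
      HaltsWithin _ I.encode _ _ (t I.n)) ∧
    (_ → 2 / 3 ≤ coinProb {ρ : Fin (t I.n) → Bool | ∃ π : List Bool,
      (π.length : ℝ) ≤ Real.logb 2 I.n ∧ Accepts _ I.encode (List.ofFn ρ) π}) ∧
    (_ → coinProb {ρ : Fin (t I.n) → Bool | ∀ π : List Bool,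
      (π.length : ℝ) ≤ Real.logb 2 I.n → Rejects _ I.encode (List.ofFn ρ) π} = 1)
  have hN : 1 ≤ valueBound C e I.n := by unfold valueBound; omega
  have hrun := fun ρ π => wp_fourSum I ρ π rfl rfl rfl rfl
  refine ⟨fun ρ π _ => ?_, fun hyes => ?_, fun hno => ?_⟩
  · obtain ⟨σ, s, hx, hs, -⟩ := hrun (List.ofFn ρ) π
    obtain ⟨T, hT, hh⟩ := hw _ _ _ _ _ _ hN hx
    refine ⟨_, T, hh, hT.trans ?_⟩
    rw [ht]
    dsimp only
    gcongr
    omega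
  · obtain ⟨S, hS, hn, hgood⟩ := exists_bad_multipliers I hyes
    have hcoins : (4 * (C * I.n ^ e)).size + Nat.log 2 I.n ≤ t I.n := by
      have h1 : (4 * (C * I.n ^ e)).size + Nat.log 2 I.n ≤ stepBound C e I.n + 1 := by
        unfold stepBound; omega
      have h2 := bitLength_pos (valueBound C e I.n)
      rw [ht]
      exact h1.trans (Nat.le_mul_of_pos_left _ (Nat.mul_pos (by omega) h2))
    refine two_thirds_le_coinProb hcoins hS fun ρ hρ => ?_
    have h0 := bitsValue_nonneg (l := List.ofFn ρ) (by simpa using hcoins)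
    obtain ⟨a, ha⟩ := Int.eq_ofNat_of_zero_le h0
    have hlt := abs_bitsValue_lt (List.ofFn ρ) ((4 * (C * I.n ^ e)).size + Nat.log 2 I.n)
    rw [abs_of_nonneg h0, ha] at hlt
    obtain ⟨i₁, hi₁, i₂, hi₂, i₃, hi₃, i₄, hi₄, hsum, hl⟩ :=
      hgood a (by exact_mod_cast hlt) (fun h => hρ a h ha) _ _ rfl rfl
    have hH : (0 : ℤ) < 2 ^ Nat.log 2 I.n := by positivity
    obtain ⟨π, hπ, hr⟩ := exists_bitsValue_eq _ (Int.emod_nonneg _ hH.ne')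
      (Int.emod_lt_of_pos (hash a (2 ^ (4 * (C * I.n ^ e)).size) (2 ^ Nat.log 2 I.n) (I.entry 0
          i₁) +
        hash a (2 ^ (4 * (C * I.n ^ e)).size) (2 ^ Nat.log 2 I.n) (I.entry 1 i₂)) hH)
    refine ⟨π, length_le_logb hn hπ, ?_⟩
    obtain ⟨σ, s, hx, -, -, hacc⟩ := hrun (List.ofFn ρ) π
    obtain ⟨T, -, hh⟩ := hw _ _ _ _ _ _ hN hx
    rw [ha] at hacc
    obtain ⟨hl1, hl2⟩ := hl _ hr
    rw [decide_eq_true (hacc i₁ hi₁ i₂ hi₂ i₃ hi₃ i₄ hi₄ hsum hr hl1 hl2)] at hh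
    exact ⟨T, hh⟩
  -- Soundness does not depend on the coins, so the event of rejection is the whole space.
  · have : {ρ : Fin (t I.n) → Bool | ∀ π : List Bool, (π.length : ℝ) ≤ Real.logb 2 I.n →
        Rejects ((fourSum C e).verifier 19) I.encode (List.ofFn ρ) π} = Set.univ := by
      refine Set.eq_univ_of_forall fun ρ π _ => ?_
      obtain ⟨σ, s, hx, -, hacc, -⟩ := hrun (List.ofFn ρ) π
      obtain ⟨T, -, hh⟩ := hw _ _ _ _ _ _ hN hx
      rw [decide_eq_false fun h => hno (hacc h)] at hh
      exact ⟨T, hh⟩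
    rw [this, coinProb, Set.ncard_univ]
    simp [Nat.card_eq_fintype_card]
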